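/- Let $H=\mathbb{C}^5$ with its canonical orthonormal basis, and let $C_2(H)$ be the set of operators $T$ on $H$ having a unitary $2$-dilation, i.e. for which there are a Hilbert space $\mathcal{H}\supseteq H$ and a unitary operator $U$ on $\mathcal{H}$ with $T^n=2P_HU^n|_H$ for all $n\ge 1$. For $T_1,T_0\in C_2(H)$ say that $T_1$ is Harnack dominated by $T_0$ if there is a constant $c\ge 1$ such that $$\operatorname{Re}p(T_1)\le c^2\operatorname{Re}p(T_0)+(c^2-1)\operatorname{Re}p(0_H)$$ for every complex polynomial $p$ with $\operatorname{Re}p\ge 0$ on the closed unit disc, where $0_H$ is the zero operator. The Harnack part of $T_0\in C_2(H)$ is the set of all $T\in C_2(H)$ such that $T$ and $T_0$ are Harnack dominated by each other. Let $$S=\frac{1}{\cos(\pi/6)}\begin{bmatrix}0&1&0&0&0\\0&0&1&0&0\\0&0&0&1&0\\0&0&0&0&1\\0&0&0&0&0\end{bmatrix},$$ and for a $5\times5$ complex matrix $T$ let $R$ be its middle $3\times 3$ block (rows and columns $2,3,4$). (1) Suppose that $T$ lies in the Harnack part of $S$ in $C_2(\mathbb{C}^5)$, that $R$ has spectrum $\{0,\lambda\}$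 for some $\lambda\in\mathbb{C}$, and that $0$ has algebraic multiplicity at least $2$ as an eigenvalue of $R$. Then $\lambda=0$, the eigenvalue $0$ of $R$ has algebraic multiplicity $3$ (so $R$ is nilpotent), and there is $\theta\in\mathbb{R}$ such that $T$ is one of $$\frac{2}{\sqrt3}\begin{bmatrix}0&1&0&0&0\\0&0&e^{i\theta}&0&0\\0&0&0&e^{-i\theta}&0\\0&0&0&0&1\\0&0&0&0&0\end{bmatrix},\qquad \begin{bmatrix}0&-\sqrt3&0&0&0\\0&0&\frac{1}{\sqrt2}e^{i\theta}&0&0\\0&0&0&\frac{1}{\sqrt2}e^{-i\theta}&0\\0&0&0&0&-\sqrt3\\0&0&0&0&0\end{bmatrix}.$$ (2) Conversely, for every $\theta\in\mathbb{R}$ both of these matrices lie in the Harnack part of $S$ in $C_2(\mathbb{C}^5)$. -/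

import Mathlib

universe u

/-- `T` is a `ρ`-contraction: it has a unitary `ρ`-dilation, that is, there are a Hilbert space `K`,
an isometric embedding `V` of `H` into `K` and a unitary operator `U` on `K` such that
`T ^ n = ρ • P_H U ^ n |_H` for all `n ≥ 1`. The compression `P_H X |_H` is written `V† X V`. -/
def IsRhoContraction {H : Type u} [NormedAddCommGroup H] [InnerProductSpace ℂ H] [CompleteSpace H]
    (ρ : ℝ) (T : H →L[ℂ] H) : Prop :=
  ∃ (K : Type u) (_ : NormedAddCommGroup K) (_ : InnerProductSpace ℂ K) (_ : CompleteSpace K)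
    (V : H →ₗᵢ[ℂ] K) (U : K →L[ℂ] K), U ∈ unitary (K →L[ℂ] K) ∧
      ∀ n : ℕ, 1 ≤ n →
        T ^ n = (ρ : ℂ) • (ContinuousLinearMap.adjoint V.toContinuousLinearMap ∘L
          (U ^ n) ∘L V.toContinuousLinearMap)

/-- `T₁` is Harnack dominated by `T₀` (in the class of `ρ`-contractions): for some `c ≥ 1`,
`Re p(T₁) ≤ c² Re p(T₀) + (c² - 1)(ρ - 1) Re p(0)` in the Loewner order, for every polynomial `p`
with nonnegative real part on the closed unit disc. -/
def HarnackDominated {H : Type u} [NormedAddCommGroup H] [InnerProductSpace ℂ H] [CompleteSpace H]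
    (ρ : ℝ) (T₁ T₀ : H →L[ℂ] H) : Prop :=
  ∃ c : ℝ, 1 ≤ c ∧ ∀ p : Polynomial ℂ, (∀ z : ℂ, ‖z‖ ≤ 1 → 0 ≤ (p.eval z).re) →
    (realPart (Polynomial.aeval T₁ p) : H →L[ℂ] H) ≤
      (c ^ 2) • (realPart (Polynomial.aeval T₀ p) : H →L[ℂ] H) +
        ((c ^ 2 - 1) * (ρ - 1)) • (realPart (Polynomial.aeval (0 : H →L[ℂ] H) p) : H →L[ℂ] H)

/-- The Harnack part of `T₀` in the class of `ρ`-contractions on `H`. -/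
def harnackPart {H : Type u} [NormedAddCommGroup H] [InnerProductSpace ℂ H] [CompleteSpace H]
    (ρ : ℝ) (T₀ : H →L[ℂ] H) : Set (H →L[ℂ] H) :=
  {T | IsRhoContraction ρ T ∧ IsRhoContraction ρ T₀ ∧
    HarnackDominated ρ T T₀ ∧ HarnackDominated ρ T₀ T}

/-- The operator on the Hilbert space `ℂ⁵` with a given matrix in the canonical basis. -/
noncomputable def matOp (M : Matrix (Fin 5) (Fin 5) ℂ) :
    EuclideanSpace ℂ (Fin 5) →L[ℂ] EuclideanSpace ℂ (Fin 5) :=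
  Matrix.toEuclideanCLM (𝕜 := ℂ) M

/-- The normalized truncated shift of size five. -/
noncomputable def shiftS : Matrix (Fin 5) (Fin 5) ℂ :=
  ((1 / Real.cos (Real.pi / 6) : ℝ) : ℂ) •
    !![0, 1, 0, 0, 0;
       0, 0, 1, 0, 0;
       0, 0, 0, 1, 0;
       0, 0, 0, 0, 1;
       0, 0, 0, 0, 0]

/-- The middle `3 × 3` block (rows and columns of index `1, 2, 3`, counted from `0`). -/
def middleBlock (T : Matrix (Fin 5) (Fin 5) ℂ) : Matrix (Fin 3) (Fin 3) ℂ :=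
  T.submatrix ![1, 2, 3] ![1, 2, 3]

/-- The first family. -/
noncomputable def familyOne (θ : ℝ) : Matrix (Fin 5) (Fin 5) ℂ :=
  ((2 / Real.sqrt 3 : ℝ) : ℂ) •
    !![0, 1, 0, 0, 0;
       0, 0, Complex.exp (Complex.I * θ), 0, 0;
       0, 0, 0, Complex.exp (-(Complex.I * θ)), 0;
       0, 0, 0, 0, 1;
       0, 0, 0, 0, 0]

/-- The second family. -/
noncomputable def familyTwo (θ : ℝ) : Matrix (Fin 5) (Fin 5) ℂ :=
  !![0, -((Real.sqrt 3 : ℝ) : ℂ), 0, 0, 0;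
     0, 0, ((1 / Real.sqrt 2 : ℝ) : ℂ) * Complex.exp (Complex.I * θ), 0, 0;
     0, 0, 0, ((1 / Real.sqrt 2 : ℝ) : ℂ) * Complex.exp (-(Complex.I * θ)), 0;
     0, 0, 0, 0, -((Real.sqrt 3 : ℝ) : ℂ);
     0, 0, 0, 0, 0]

/-! Everything is read off from the block Toeplitz form of the powers of an operator. If `T` has a
unitary 2-dilation `U`, its form at vectors `w k` equals `‖∑ U ^ k V (w k)‖ ^ 2`
(`toeplitzForm_eq_norm_sq`). Averaging Poisson kernels over roots of unity turns Harnack domination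
into an inequality between these forms, up to a constant (`HarnackDominated.toeplitzForm_le`).

Necessity. The form of `S` vanishes at the vectors `familyKernel k • e k`, so the form of `T`
vanishes there too. The dilated sum is then zero, and compressing its translates by powers of `U`
gives linear relations for `T` and its adjoint (`toeplitz_kernel_recursion`). They kill the first
column and the last row of `T`. The rest is a system for the middle block `R` and three vectors of
`ℂ³`. By Cayley–Hamilton `R ^ 3 = ν R ^ 2`, and power boundedness gives `‖ν‖ ^ 2 < 2`. Then
`middle_rigidity` computes all inner products between the vectors and compares them in a plane: `ν =
0` and `‖g‖ ^ 2` is 12 or 2. These two values yield the two families, the phase of one coordinate of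
`g` giving `θ`.

Sufficiency. For a weighted shift `W` let `Z` be the sum of its powers. The Schur product of `Z +
Zᴴ` with the Toeplitz matrix of `2 Re p` is `2 Re p(W) + 2 Re p(0)`. Positivity of `Z + Zᴴ` gives a
2-dilation (`isRhoContraction_of_gram`). Two positive semidefinite matrices with the same kernel are
comparable, and the Schur product theorem turns this into Harnack domination
(`harnackDominated_of_gram`). It remains to see that all members of both families share one kernel
line, which an explicit factorization shows (`weightedShift_gram`). -/

open scoped InnerProductSpace ComplexConjugate

/-! ### Rigidity of the relations in a three-dimensional space -/

/-- In a three-dimensional space, a vector orthogonal to three nonzero pairwise orthogonal vectors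
vanishes. -/
theorem eq_zero_of_inner_orthogonal_triple {E : Type*} [NormedAddCommGroup E]
    [InnerProductSpace ℂ E] (hE : Module.finrank ℂ E = 3) {u v w x : E}
    (hu : u ≠ 0) (hv : v ≠ 0) (hw : w ≠ 0) (huv : ⟪u, v⟫_ℂ = 0) (huw : ⟪u, w⟫_ℂ = 0)
    (hvw : ⟪v, w⟫_ℂ = 0) (hxu : ⟪u, x⟫_ℂ = 0) (hxv : ⟪v, x⟫_ℂ = 0) (hxw : ⟪w, x⟫_ℂ = 0) :
    x = 0 := by
  have hvu := inner_eq_zero_symm.1 huv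
  have hwu := inner_eq_zero_symm.1 huw
  have hwv := inner_eq_zero_symm.1 hvw
  have hli : LinearIndependent ℂ ![u, v, w] := by
    apply linearIndependent_of_ne_zero_of_inner_eq_zero
    · intro i
      fin_cases i <;> simpa
    · intro i j hij
      fin_cases i <;> fin_cases j <;> simp_all
  have hspan := hli.span_eq_top_of_card_eq_finrank (by simp [hE])
  have hx : x ∈ Submodule.span ℂ (Set.range ![u, v, w]) := by rw [hspan]; trivial
  have hall : ∀ y ∈ Submodule.span ℂ (Set.range ![u, v, w]), ⟪y, x⟫_ℂ = 0 := by
    intro y hy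
    induction hy using Submodule.span_induction with
    | mem y hy =>
      obtain ⟨i, rfl⟩ := hy
      fin_cases i <;> simpa
    | zero => simp
    | add a b _ _ ha hb => rw [inner_add_left, ha, hb, add_zero]
    | smul c a _ ha => rw [inner_smul_left, ha, mul_zero]
  exact inner_self_eq_zero.1 (hall x hx)

/-- Parameters of a pair of vectors with prescribed inner products against an orthogonal pair
`k, l` of equal norms in a plane. -/
theorem scalar_rigidity {M N : ℝ} {W Q : ℂ} (hN : 0 < N) (hM : 0 < M)
    (h1 : 2 * Q * (M - N) = N * W)
    (h2 : Complex.normSq (W / 4 - Q / 2) = Complex.normSq Q) :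
    W = 0 ∧ Q = 0 ∨ M = 4 * N := by
  -- Eliminating `W` makes `W / 4 - Q / 2` a real multiple of `Q`. Equality of moduli then forces `Q
  -- = 0` or `(M - 2 N) ^ 2 = 4 N ^ 2`.
  have h3 : (N : ℂ) * (W / 4 - Q / 2) = ((M - 2 * N) / 2 : ℝ) * Q := by
    push_cast
    linear_combination (-1 / 4 : ℂ) * h1
  have h4 := congrArg Complex.normSq h3
  rw [map_mul, map_mul, h2, Complex.normSq_ofReal, Complex.normSq_ofReal] at h4
  have hNC : (N : ℂ) ≠ 0 := by exact_mod_cast hN.ne'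
  by_cases hQ : Q = 0
  · left
    refine ⟨?_, hQ⟩
    subst hQ
    simpa [hNC] using h1
  · right
    have hq : Complex.normSq Q ≠ 0 := by simpa using hQ
    have h5 : N * N = (M - 2 * N) / 2 * ((M - 2 * N) / 2) := mul_right_cancel₀ hq h4
    have h6 : M * (M - 4 * N) = 0 := by linear_combination -4 * h5
    rcases mul_eq_zero.1 h6 with h | h
    · exact absurd h hM.ne'
    · linarith

/-- The rigidity of the compression to the middle block: an operator `R` on a three-dimensional
space with `R ^ 3 = μ R ^ 2` and with the listed kernel relations has `μ = 0`, and there are only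
two possible shapes. -/
theorem middle_rigidity {E : Type*} [NormedAddCommGroup E]
    [InnerProductSpace ℂ E] (hE : Module.finrank ℂ E = 3) (R Rs : E →ₗ[ℂ] E)
    (hadj : ∀ x y, ⟪Rs x, y⟫_ℂ = ⟪x, R y⟫_ℂ) {μ : ℂ} (hμ : ‖μ‖ ^ 2 < 2)
    (hR : ∀ x, R (R (R x)) = μ • R (R x)) {a b f g h : E}
    (hRh : R h = g) (hRf : Rs f = g) (hf : f = a + R g) (hh : h = b + Rs g)
    (ha : ⟪a, a⟫_ℂ = 1) (hb : ⟪b, b⟫_ℂ = 1) (hab : ⟪a, b⟫_ℂ = 0)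
    (hfg : ⟪f + a, g⟫_ℂ = 0) (hfh : ⟪f + a, h⟫_ℂ = 0) (hff : ⟪f + a, f⟫_ℂ = 6)
    (hhh : ⟪h + b, h⟫_ℂ = 6) :
    μ = 0 ∧ ⟪g, a⟫_ℂ = 0 ∧ ⟪g, b⟫_ℂ = 0 ∧
      (‖g‖ ^ 2 = 12 ∧ R g = (-4 : ℂ) • a ∧ Rs g = (-4 : ℂ) • b ∨
       ‖g‖ ^ 2 = 2 ∧ R g = a ∧ Rs g = b) := by
  obtain ⟨k, hk⟩ : ∃ k, k = R g := ⟨_, rfl⟩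
  obtain ⟨l, hl⟩ : ∃ l, l = Rs g := ⟨_, rfl⟩
  rw [← hk] at hf
  rw [← hl] at hh
  obtain rfl : a = f - k := by rw [hf]; abel
  obtain rfl : b = h - l := by rw [hh]; abel
  -- Since `k = R (R h)`, the cubic relation gives `R k = μ k`. This closes the table of inner
  -- products of `f, g, h, k, l`.
  have hRk : R k = μ • k := by rw [hk, ← hRh, hR]
  obtain ⟨G, hG⟩ : ∃ G : ℝ, G = ‖g‖ ^ 2 := ⟨_, rfl⟩
  have gg : ⟪g, g⟫_ℂ = G := by rw [inner_self_eq_norm_sq_to_K, hG]; norm_cast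
  have fk : ⟪f, k⟫_ℂ = G := by rw [hk, ← hadj, hRf, gg]
  have gk : ⟪g, k⟫_ℂ = μ * G := by
    rw [← hRf, hadj, hRk, inner_smul_right, fk]
  have kf : ⟪k, f⟫_ℂ = G := by rw [← inner_conj_symm, fk, Complex.conj_ofReal]
  have kg : ⟪k, g⟫_ℂ = conj μ * G := by
    rw [← inner_conj_symm, gk, map_mul, Complex.conj_ofReal]
  have fg : ⟪f, g⟫_ℂ = conj μ * G / 2 := by
    simp only [inner_add_left, inner_sub_left, kg] at hfg
    linear_combination hfg / 2
  have gf : ⟪g, f⟫_ℂ = μ * G / 2 := by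
    rw [← inner_conj_symm, fg]
    simp [Complex.conj_ofNat]
  have gh : ⟪g, h⟫_ℂ = conj μ * G / 2 := by rw [← fg, ← hRf, hadj, hRh, hRf]
  have hg : ⟪h, g⟫_ℂ = μ * G / 2 := by
    rw [← inner_conj_symm, gh]
    simp [Complex.conj_ofNat]
  have lh : ⟪l, h⟫_ℂ = G := by rw [hl, hadj, hRh, gg]
  have hl' : ⟪h, l⟫_ℂ = G := by rw [← inner_conj_symm, lh, Complex.conj_ofReal]
  have lg : ⟪l, g⟫_ℂ = μ * G := by rw [hl, hadj, ← hk, gk]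
  have gl : ⟪g, l⟫_ℂ = conj μ * G := by
    rw [← inner_conj_symm, lg, map_mul, Complex.conj_ofReal]
  have lk : ⟪l, k⟫_ℂ = μ ^ 2 * G := by
    rw [hl, hadj, hRk, inner_smul_right, gk]; ring
  have kl : ⟪k, l⟫_ℂ = conj μ ^ 2 * G := by
    rw [← inner_conj_symm, lk, map_mul, map_pow, Complex.conj_ofReal]
  have ff : ⟪f, f⟫_ℂ = 3 + G / 2 := by
    simp only [inner_add_left, inner_sub_left, kf] at hff
    linear_combination hff / 2
  have hh' : ⟪h, h⟫_ℂ = 3 + G / 2 := by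
    simp only [inner_add_left, inner_sub_left, lh] at hhh
    linear_combination hhh / 2
  have kk : ⟪k, k⟫_ℂ = 3 * G / 2 - 2 := by
    simp only [inner_sub_right, inner_sub_left, kf, fk, ff] at ha
    linear_combination ha
  have ll : ⟪l, l⟫_ℂ = 3 * G / 2 - 2 := by
    simp only [inner_sub_right, inner_sub_left, lh, hl', hh'] at hb
    linear_combination hb
  have hG0 : g ≠ 0 := by
    rintro rfl
    have hk0 : k = 0 := by rw [hk, map_zero]
    rw [hk0, hG] at kk
    norm_num at kk
  have hGpos : 0 < G := by rw [hG]; positivity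
  -- The only parameter of the table besides `G` and `μ`.
  obtain ⟨q, hq⟩ : ∃ q, q = ⟪h, k⟫_ℂ := ⟨_, rfl⟩
  have kh : ⟪k, h⟫_ℂ = conj q := by rw [hq, inner_conj_symm]
  have fh : ⟪f, h⟫_ℂ = conj q / 2 := by
    simp only [inner_add_left, inner_sub_left, kh] at hfh
    linear_combination hfh / 2
  have hf' : ⟪h, f⟫_ℂ = q / 2 := by
    rw [← inner_conj_symm, fh]
    simp [Complex.conj_ofNat]
  have fl : ⟪f, l⟫_ℂ = conj μ ^ 2 * G - conj q / 2 := by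
    simp only [inner_sub_right, inner_sub_left, fh, kh, kl] at hab
    linear_combination -hab
  have lf : ⟪l, f⟫_ℂ = μ ^ 2 * G - q / 2 := by
    rw [← inner_conj_symm, fl]
    simp [Complex.conj_ofNat]
  obtain ⟨m, hm⟩ : ∃ m : ℝ, m = ‖μ‖ ^ 2 := ⟨_, rfl⟩
  have hmC : conj μ * μ = m := by
    rw [hm, mul_comm, Complex.mul_conj, Complex.normSq_eq_norm_sq]
  rw [← hm] at hμ
  -- the components orthogonal to `g`
  obtain ⟨f', hf1⟩ : ∃ f', f' = f - (μ / 2) • g := ⟨_, rfl⟩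
  obtain ⟨h', hh1⟩ : ∃ h', h' = h - (conj μ / 2) • g := ⟨_, rfl⟩
  obtain ⟨k', hk1⟩ : ∃ k', k' = k - μ • g := ⟨_, rfl⟩
  obtain ⟨l', hl1⟩ : ∃ l', l' = l - conj μ • g := ⟨_, rfl⟩
  obtain ⟨M, hM⟩ : ∃ M : ℝ, M = 3 * G / 2 - 2 - m * G := ⟨_, rfl⟩
  obtain ⟨N, hN⟩ : ∃ N : ℝ, N = G - m * G / 2 := ⟨_, rfl⟩
  obtain ⟨Q, hQ⟩ : ∃ Q : ℂ, Q = q - μ ^ 2 * G / 2 := ⟨_, rfl⟩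
  obtain ⟨D, hD⟩ : ∃ D : ℂ, D = μ ^ 2 * G / 4 - Q / 2 := ⟨_, rfl⟩
  have gf' : ⟪g, f'⟫_ℂ = 0 := by
    rw [hf1, inner_sub_right, inner_smul_right, gf, gg]; ring
  have gh' : ⟪g, h'⟫_ℂ = 0 := by
    rw [hh1, inner_sub_right, inner_smul_right, gh, gg]; ring
  have gk' : ⟪g, k'⟫_ℂ = 0 := by
    rw [hk1, inner_sub_right, inner_smul_right, gk, gg]; ring
  have gl' : ⟪g, l'⟫_ℂ = 0 := by
    rw [hl1, inner_sub_right, inner_smul_right, gl, gg]; ring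
  have expand : ∀ (x y z : E) (c : ℂ), ⟪g, z⟫_ℂ = 0 → x = y - c • g → ⟪x, z⟫_ℂ = ⟪y, z⟫_ℂ := by
    intro x y z c hz hx
    rw [hx, inner_sub_left, inner_smul_left, hz, mul_zero, sub_zero]
  have kk' : ⟪k', k'⟫_ℂ = M := by
    rw [expand _ _ _ _ gk' hk1, hk1, inner_sub_right, inner_smul_right, kk, kg, hM]
    push_cast
    linear_combination (-G : ℂ) * hmC
  have ll' : ⟪l', l'⟫_ℂ = M := by
    rw [expand _ _ _ _ gl' hl1, hl1, inner_sub_right, inner_smul_right, ll, lg, hM]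
    push_cast
    linear_combination (-G : ℂ) * hmC
  have kf' : ⟪k', f'⟫_ℂ = N := by
    rw [expand _ _ _ _ gf' hk1, hf1, inner_sub_right, inner_smul_right, kf, kg, hN]
    push_cast
    linear_combination (-G / 2 : ℂ) * hmC
  have lh' : ⟪l', h'⟫_ℂ = N := by
    rw [expand _ _ _ _ gh' hl1, hh1, inner_sub_right, inner_smul_right, lh, lg, hN]
    push_cast
    linear_combination (-G / 2 : ℂ) * hmC
  have lk' : ⟪l', k'⟫_ℂ = 0 := by
    rw [expand _ _ _ _ gk' hl1, hk1, inner_sub_right, inner_smul_right, lk, lg]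
    ring
  have kl' : ⟪k', l'⟫_ℂ = 0 := inner_eq_zero_symm.1 lk'
  have hk' : ⟪h', k'⟫_ℂ = Q := by
    rw [expand _ _ _ _ gk' hh1, hk1, inner_sub_right, inner_smul_right, ← hq, hg, hQ]
    ring
  have hf'' : ⟪h', f'⟫_ℂ = Q / 2 := by
    rw [expand _ _ _ _ gf' hh1, hf1, inner_sub_right, inner_smul_right, hf', hg, hQ]
    ring
  have lf' : ⟪l', f'⟫_ℂ = D := by
    rw [expand _ _ _ _ gf' hl1, hf1, inner_sub_right, inner_smul_right, lf, lg, hD, hQ]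
    ring
  have ff' : ⟪f', f'⟫_ℂ = 3 + G / 2 - m * G / 4 := by
    rw [expand _ _ _ _ gf' hf1, hf1, inner_sub_right, inner_smul_right, ff, fg]
    linear_combination (-G / 4 : ℂ) * hmC
  have hh'' : ⟪h', h'⟫_ℂ = 3 + G / 2 - m * G / 4 := by
    rw [expand _ _ _ _ gh' hh1, hh1, inner_sub_right, inner_smul_right, hh', hg]
    linear_combination (-G / 4 : ℂ) * hmC
  have fk' : ⟪f', k'⟫_ℂ = N := by rw [← inner_conj_symm, kf', Complex.conj_ofReal]
  have hl'' : ⟪h', l'⟫_ℂ = N := by rw [← inner_conj_symm, lh', Complex.conj_ofReal]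
  have fl' : ⟪f', l'⟫_ℂ = conj D := by rw [← inner_conj_symm, lf']
  have kh' : ⟪k', h'⟫_ℂ = conj Q := by rw [← inner_conj_symm, hk']
  have hNpos : 0 < N := by rw [hN]; nlinarith
  have hNC : (N : ℂ) ≠ 0 := by exact_mod_cast hNpos.ne'
  have hk0 : k' ≠ 0 := by
    rintro h0
    rw [h0, inner_zero_left] at kf'
    exact hNC kf'.symm
  have hl0 : l' ≠ 0 := by
    rintro h0
    rw [h0, inner_zero_left] at lh'
    exact hNC lh'.symm
  have hMpos : 0 < M := by
    have h1 : (M : ℂ) = ((‖k'‖ ^ 2 : ℝ) : ℂ) := by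
      rw [← kk', inner_self_eq_norm_sq_to_K]; norm_cast
    rw [Complex.ofReal_inj.1 h1]
    positivity
  -- The orthogonal complement of `g` is a plane in which `k'` and `l'` are orthogonal of equal
  -- norm, so `f'` and `h'` can be expanded in them. Pairing the expansions with `f'` and `h'` gives
  -- the scalar equations.
  have vf : (M : ℂ) • f' = (N : ℂ) • k' + D • l' := by
    rw [← sub_eq_zero]
    apply eq_zero_of_inner_orthogonal_triple hE hG0 hk0 hl0 gk' gl' kl'
    · simp only [inner_sub_right, inner_add_right, inner_smul_right, gf', gk', gl']; ring
    · simp only [inner_sub_right, inner_add_right, inner_smul_right, kf', kk', kl']; ring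
    · simp only [inner_sub_right, inner_add_right, inner_smul_right, lf', lk', ll']; ring
  have vh : (M : ℂ) • h' = conj Q • k' + (N : ℂ) • l' := by
    rw [← sub_eq_zero]
    apply eq_zero_of_inner_orthogonal_triple hE hG0 hk0 hl0 gk' gl' kl'
    · simp only [inner_sub_right, inner_add_right, inner_smul_right, gh', gk', gl']; ring
    · simp only [inner_sub_right, inner_add_right, inner_smul_right, kh', kk', kl']; ring
    · simp only [inner_sub_right, inner_add_right, inner_smul_right, lh', lk', ll']; ring
  have e1 : (M : ℂ) * (Q / 2) = N * Q + D * N := by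
    have := congrArg (fun x => ⟪h', x⟫_ℂ) vf
    simpa only [inner_add_right, inner_smul_right, hf'', hk', hl''] using this
  have e2 : (M : ℂ) * (3 + G / 2 - m * G / 4) = N * N + D * conj D := by
    have := congrArg (fun x => ⟪f', x⟫_ℂ) vf
    simpa only [inner_add_right, inner_smul_right, ff', fk', fl'] using this
  have e3 : (M : ℂ) * (3 + G / 2 - m * G / 4) = conj Q * Q + N * N := by
    have := congrArg (fun x => ⟪h', x⟫_ℂ) vh
    simpa only [inner_add_right, inner_smul_right, hh'', hk', hl''] using this
  have e4 : Complex.normSq (μ ^ 2 * G / 4 - Q / 2) = Complex.normSq Q := by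
    have : D * conj D = Q * conj Q := by linear_combination e3 - e2
    rw [Complex.mul_conj, Complex.mul_conj] at this
    rw [← hD]
    exact_mod_cast this
  have e5 : 2 * Q * ((M : ℂ) - N) = N * (μ ^ 2 * G) := by
    rw [hD] at e1
    linear_combination 4 * e1
  rcases scalar_rigidity hNpos hMpos e5 e4 with ⟨hW, hQ0⟩ | h4
  · have hμ0 : μ = 0 := by
      have hGC : (G : ℂ) ≠ 0 := by exact_mod_cast hGpos.ne'
      simpa [hGC] using hW
    have hm0 : m = 0 := by rw [hm, hμ0]; simp
    have hD0 : D = 0 := by rw [hD, hQ0, hμ0]; simp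
    subst hμ0 hm0 hD0 hQ0
    simp only [zero_div, map_zero, zero_smul, sub_zero] at hf1 hh1 hk1 hl1
    subst hf1 hh1 hk1 hl1
    simp only [map_zero, zero_smul, zero_add, add_zero] at vf vh
    refine ⟨rfl, by rw [inner_sub_right, gf', gk', sub_zero],
      by rw [inner_sub_right, gh', gl', sub_zero], ?_⟩
    rw [← hk, ← hl, ← hG]
    have e6 : M * (3 + G / 2) = N * N := by
      have : (M : ℂ) * (3 + G / 2) = N * N := by simpa using e2
      exact_mod_cast this
    simp only [zero_mul, zero_div, sub_zero] at hM hN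
    rw [hM, hN] at e6
    -- With `μ = 0` the norm equation reads `(3G/2 - 2)(3 + G/2) = G²`.
    have e7 : (G - 12) * (G - 2) = 0 := by linear_combination -4 * e6
    rcases mul_eq_zero.1 e7 with h | h
    · left
      have hG12 : G = 12 := by linarith
      subst hG12
      norm_num at hM hN
      subst hM hN
      refine ⟨rfl, ?_, ?_⟩
      · have : f' = (3 / 4 : ℂ) • k' := by
          have h16 : (16 : ℂ) ≠ 0 := by norm_num
          apply smul_right_injective E h16
          simp only [smul_smul]
          convert vf using 2 <;> norm_num
        rw [this]; module
      · have : h' = (3 / 4 : ℂ) • l' := by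
          have h16 : (16 : ℂ) ≠ 0 := by norm_num
          apply smul_right_injective E h16
          simp only [smul_smul]
          convert vh using 2 <;> norm_num
        rw [this]; module
    · right
      have hG2 : G = 2 := by linarith
      subst hG2
      norm_num at hM hN
      subst hM hN
      simp only [Complex.ofReal_one, one_smul, Complex.ofReal_ofNat] at vf vh
      refine ⟨rfl, ?_, ?_⟩
      · rw [vf]; module
      · rw [vh]; module
  -- Here `M = 4 N` amounts to `m G = 5G/2 + 2`, impossible for `m < 2`.
  · exfalso
    rw [hM, hN] at h4
    nlinarith

/-! ### Quadrature on roots of unity -/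

/-- Orthogonality of the powers on the `M`-th roots of unity. -/
theorem sum_conj_pow_mul_pow_of_isPrimitiveRoot {M : ℕ} {ω : ℂ} (hω : IsPrimitiveRoot ω M)
    (hn : ‖ω‖ = 1) {a b : ℕ} (hab : a < b + M) (hba : b < a + M) :
    ∑ i ∈ Finset.range M, conj (ω ^ i) ^ a * (ω ^ i) ^ b = if a = b then (M : ℂ) else 0 := by
  have hω0 : ω ≠ 0 := by
    rintro rfl
    simp at hn
  have hconj : conj ω = ω⁻¹ := (Complex.inv_eq_conj hn).symm
  have hterm : ∀ i : ℕ, conj (ω ^ i) ^ a * (ω ^ i) ^ b = (ω ^ ((b : ℤ) - a)) ^ i := by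
    intro i
    rw [map_pow, hconj, ← zpow_natCast, ← zpow_natCast, ← zpow_natCast, ← zpow_natCast,
      ← zpow_natCast, ← zpow_mul, ← zpow_mul, ← zpow_mul, inv_zpow', ← zpow_add₀ hω0]
    congr 1
    ring
  rw [Finset.sum_congr rfl fun i _ => hterm i]
  split_ifs with h
  · simp [h]
  · have hne : ω ^ ((b : ℤ) - a) ≠ 1 := by
      rw [Ne, hω.zpow_eq_one_iff_dvd]
      rintro ⟨c, hc⟩
      have h1 : (b : ℤ) - a < M := by omega
      have h2 : -(M : ℤ) < (b : ℤ) - a := by omega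
      rw [hc] at h1 h2
      have hM : (0 : ℤ) < M := by omega
      have hc1 : c < 1 := by nlinarith
      have hc2 : -1 < c := by nlinarith
      have : c = 0 := by omega
      subst this
      omega
    rw [geom_sum_eq hne, ← zpow_natCast, ← zpow_mul, mul_comm, zpow_mul, zpow_natCast,
      hω.pow_eq_one, one_zpow, sub_self, zero_div]

/-! ### From Harnack domination to block Toeplitz forms -/

section Harnack

variable {H : Type*} [NormedAddCommGroup H] [InnerProductSpace ℂ H]

theorem re_inner_realPart [CompleteSpace H] (A : H →L[ℂ] H) (x : H) :
    (⟪(realPart A : H →L[ℂ] H) x, x⟫_ℂ).re = (⟪x, A x⟫_ℂ).re := by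
  rw [realPart_apply_coe, smul_apply, add_apply,
    inner_smul_left_eq_smul, inner_add_left, ContinuousLinearMap.star_eq_adjoint,
    ContinuousLinearMap.adjoint_inner_left, ← inner_conj_symm (A x) x, Complex.smul_re,
    Complex.add_re, Complex.conj_re, smul_eq_mul]
  ring

/-- Harnack domination in terms of quadratic forms. -/
theorem harnackDominated_iff [CompleteSpace H] (ρ : ℝ) (T₁ T₀ : H →L[ℂ] H) :
    HarnackDominated ρ T₁ T₀ ↔ ∃ c : ℝ, 1 ≤ c ∧ ∀ p : Polynomial ℂ,
      (∀ z : ℂ, ‖z‖ ≤ 1 → 0 ≤ (p.eval z).re) → ∀ x : H,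
        (⟪x, Polynomial.aeval T₁ p x⟫_ℂ).re ≤ c ^ 2 * (⟪x, Polynomial.aeval T₀ p x⟫_ℂ).re +
          (c ^ 2 - 1) * (ρ - 1) * (⟪x, Polynomial.aeval (0 : H →L[ℂ] H) p x⟫_ℂ).re := by
  refine exists_congr fun c => and_congr_right fun _ => forall_congr' fun p =>
    imp_congr_right fun _ => ?_
  rw [ContinuousLinearMap.le_def, ContinuousLinearMap.isPositive_def']
  have hsa : IsSelfAdjoint ((c ^ 2) • (realPart (Polynomial.aeval T₀ p) : H →L[ℂ] H) +
        ((c ^ 2 - 1) * (ρ - 1)) • (realPart (Polynomial.aeval (0 : H →L[ℂ] H) p) : H →L[ℂ] H) -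
        (realPart (Polynomial.aeval T₁ p) : H →L[ℂ] H)) := by
    refine IsSelfAdjoint.sub (IsSelfAdjoint.add ?_ ?_) (realPart _).2
    · exact IsSelfAdjoint.smul (IsSelfAdjoint.all _) (realPart _).2
    · exact IsSelfAdjoint.smul (IsSelfAdjoint.all _) (realPart _).2
  rw [and_iff_right hsa]
  refine forall_congr' fun x => ?_
  rw [ContinuousLinearMap.reApplyInnerSelf_apply, sub_apply,
    add_apply, smul_apply, smul_apply,
    inner_sub_left, inner_add_left, inner_smul_left_eq_smul, inner_smul_left_eq_smul]
  simp only [RCLike.re_to_complex, Complex.sub_re, Complex.add_re, Complex.smul_re, smul_eq_mul,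
    re_inner_realPart]
  rw [sub_nonneg]

/-- The quadratic form of the block Toeplitz matrix of the powers of `T`. -/
noncomputable def toeplitzForm (T : H →L[ℂ] H) (r : ℝ) (n : ℕ) (w : ℕ → H) : ℝ :=
  ∑ j ∈ Finset.range n, ‖w j‖ ^ 2 +
    ∑ j ∈ Finset.range n, ∑ k ∈ Finset.range n,
      if j < k then r ^ (k - j) * (⟪w j, (T ^ (k - j)) (w k)⟫_ℂ).re else 0

/-- The full series is `(1 + x) / (1 - x)`, of nonnegative real part on the disc. The added constant
dominates the truncated tail `2 x ^ (N + 1) / (1 - x)`, so a genuine polynomial becomes an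
admissible test function. -/
theorem re_one_add_two_mul_geom_sum_nonneg {r : ℝ} (hr1 : r < 1) (N : ℕ) {x : ℂ}
    (hx : ‖x‖ ≤ r) :
    0 ≤ (1 + 2 * (r ^ (N + 1) / (1 - r) : ℝ) +
      2 * ∑ n ∈ Finset.range N, x ^ (n + 1) : ℂ).re := by
  have hx1 : ‖x‖ < 1 := hx.trans_lt hr1
  have hne : 1 - x ≠ 0 := by
    intro h
    rw [← sub_eq_zero.1 h] at hx1
    simp at hx1
  have hx' : x ≠ 1 := fun h => hne (by rw [h, sub_self])
  have hsum : (1 : ℂ) + 2 * ∑ n ∈ Finset.range N, x ^ (n + 1) =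
      (1 + x) / (1 - x) - 2 * (x ^ (N + 1) / (1 - x)) := by
    have h1 : ∑ n ∈ Finset.range N, x ^ (n + 1) = x * ∑ n ∈ Finset.range N, x ^ n := by
      rw [Finset.mul_sum]
      exact Finset.sum_congr rfl fun n _ => pow_succ' x n
    have h2 := mul_neg_geom_sum x N
    rw [h1]
    field_simp
    linear_combination 2 * x * h2
  have hpos : 0 ≤ ((1 + x) / (1 - x)).re := by
    rw [Complex.div_re]
    have : (1 + x).re * (1 - x).re + (1 + x).im * (1 - x).im = 1 - Complex.normSq x := by
      simp [Complex.normSq_apply]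
      ring
    rw [← add_div, this]
    apply div_nonneg _ (Complex.normSq_nonneg _)
    rw [Complex.normSq_eq_norm_sq]
    nlinarith [norm_nonneg x]
  have htail : ‖x ^ (N + 1) / (1 - x)‖ ≤ r ^ (N + 1) / (1 - r) := by
    rw [norm_div, norm_pow]
    have h1 : 1 - r ≤ ‖1 - x‖ := by
      have := norm_sub_norm_le (1 : ℂ) x
      rw [norm_one] at this
      linarith
    have : 0 < 1 - r := by linarith
    have := (norm_nonneg x).trans hx
    gcongr
  have hre := (Complex.re_le_norm (x ^ (N + 1) / (1 - x))).trans htail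
  have : (1 + 2 * (r ^ (N + 1) / (1 - r) : ℝ) + 2 * ∑ n ∈ Finset.range N, x ^ (n + 1) : ℂ) =
      (1 + x) / (1 - x) - 2 * (x ^ (N + 1) / (1 - x)) + 2 * (r ^ (N + 1) / (1 - r) : ℝ) := by
    rw [← hsum]; ring
  rw [this]
  simp only [Complex.add_re, Complex.sub_re, Complex.mul_re, Complex.re_ofNat, Complex.im_ofNat,
    Complex.ofReal_re, zero_mul, sub_zero]
  linarith

/-- A polynomial approximation of the Poisson kernel. -/
noncomputable def poissonPolynomial (r : ℝ) (N : ℕ) (ζ : ℂ) : Polynomial ℂ :=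
  Polynomial.C (1 + 2 * (r ^ (N + 1) / (1 - r) : ℝ) : ℂ) +
    ∑ n ∈ Finset.range N,
      Polynomial.C (2 * ((r ^ (n + 1) : ℝ) : ℂ) * conj ζ ^ (n + 1)) * Polynomial.X ^ (n + 1)

theorem poissonPolynomial_re_nonneg {r : ℝ} (hr0 : 0 ≤ r) (hr1 : r < 1) (N : ℕ) {ζ : ℂ}
    (hζ : ‖ζ‖ = 1) (z : ℂ) (hz : ‖z‖ ≤ 1) :
    0 ≤ ((poissonPolynomial r N ζ).eval z).re := by
  have hx : ‖(r : ℂ) * conj ζ * z‖ ≤ r := by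
    rw [norm_mul, norm_mul, RCLike.norm_conj, hζ, Complex.norm_real, Real.norm_eq_abs,
      abs_of_nonneg hr0, mul_one]
    exact mul_le_of_le_one_right hr0 hz
  have h := re_one_add_two_mul_geom_sum_nonneg hr1 N hx
  convert h using 2
  rw [poissonPolynomial, Polynomial.eval_add, Polynomial.eval_finsetSum, Polynomial.eval_C,
    Finset.mul_sum]
  congr 1
  refine Finset.sum_congr rfl fun n _ => ?_
  simp only [Polynomial.eval_mul, Polynomial.eval_C, Polynomial.eval_pow, Polynomial.eval_X]
  push_cast
  ring

theorem re_inner_aeval_poissonPolynomial (T : H →L[ℂ] H) (r : ℝ) (N : ℕ) (ζ : ℂ) (x : H) :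
    (⟪x, Polynomial.aeval T (poissonPolynomial r N ζ) x⟫_ℂ).re =
      (1 + 2 * (r ^ (N + 1) / (1 - r))) * ‖x‖ ^ 2 +
        2 * ∑ n ∈ Finset.range N,
          r ^ (n + 1) * (conj ζ ^ (n + 1) * ⟪x, (T ^ (n + 1)) x⟫_ℂ).re := by
  have hxx : ⟪x, x⟫_ℂ = ((‖x‖ ^ 2 : ℝ) : ℂ) := by
    rw [inner_self_eq_norm_sq_to_K]; norm_cast
  rw [poissonPolynomial, map_add, map_sum, add_apply, inner_add_right,
    sum_apply, inner_sum, Complex.add_re, Complex.re_sum, Finset.mul_sum]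
  congr 1
  · rw [Polynomial.aeval_C, Algebra.algebraMap_eq_smul_one, smul_apply,
      one_apply_eq_self, inner_smul_right, hxx]
    have : (1 + 2 * (r ^ (N + 1) / (1 - r) : ℝ) : ℂ) =
      ((1 + 2 * (r ^ (N + 1) / (1 - r)) : ℝ) : ℂ) := by push_cast; rfl
    rw [this, ← Complex.ofReal_mul, Complex.ofReal_re]
  · refine Finset.sum_congr rfl fun n _ => ?_
    rw [map_mul, map_pow, Polynomial.aeval_C, Polynomial.aeval_X,
      Algebra.algebraMap_eq_smul_one, smul_mul_assoc, one_mul, smul_apply,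
      inner_smul_right]
    have : (2 * ((r ^ (n + 1) : ℝ) : ℂ) * conj ζ ^ (n + 1)) * ⟪x, (T ^ (n + 1)) x⟫_ℂ =
      ((2 * r ^ (n + 1) : ℝ) : ℂ) * (conj ζ ^ (n + 1) * ⟪x, (T ^ (n + 1)) x⟫_ℂ) := by
      push_cast; ring
    rw [this, Complex.re_ofReal_mul]
    ring

/-- Averaging a sesquilinear expression over roots of unity extracts a diagonal. -/
theorem sum_conj_pow_mul_inner_of_isPrimitiveRoot {M : ℕ} {ω : ℂ} (hω : IsPrimitiveRoot ω M)
    (hn : ‖ω‖ = 1) (A : H →L[ℂ] H) (n m : ℕ) (hM : m + n < M) (w : ℕ → H) :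
    ∑ i ∈ Finset.range M, conj (ω ^ i) ^ m *
        ⟪∑ j ∈ Finset.range n, (ω ^ i) ^ j • w j, A (∑ k ∈ Finset.range n, (ω ^ i) ^ k • w k)⟫_ℂ =
      M * ∑ j ∈ Finset.range n, ∑ k ∈ Finset.range n,
        if m + j = k then ⟪w j, A (w k)⟫_ℂ else 0 := by
  have h1 : ∀ i : ℕ, conj (ω ^ i) ^ m *
        ⟪∑ j ∈ Finset.range n, (ω ^ i) ^ j • w j, A (∑ k ∈ Finset.range n, (ω ^ i) ^ k • w k)⟫_ℂ =
      ∑ j ∈ Finset.range n, ∑ k ∈ Finset.range n,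
        conj (ω ^ i) ^ (m + j) * (ω ^ i) ^ k * ⟪w j, A (w k)⟫_ℂ := by
    intro i
    rw [sum_inner, Finset.mul_sum]
    refine Finset.sum_congr rfl fun j _ => ?_
    rw [map_sum, inner_sum, Finset.mul_sum]
    refine Finset.sum_congr rfl fun k _ => ?_
    rw [map_smul, inner_smul_left, inner_smul_right, map_pow (starRingEnd ℂ) (ω ^ i) j, pow_add]
    ring
  rw [Finset.sum_congr rfl fun i _ => h1 i, Finset.sum_comm, Finset.mul_sum]
  refine Finset.sum_congr rfl fun j hj => ?_
  rw [Finset.sum_comm, Finset.mul_sum]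
  refine Finset.sum_congr rfl fun k hk => ?_
  rw [Finset.mem_range] at hj hk
  rw [← Finset.sum_mul, sum_conj_pow_mul_pow_of_isPrimitiveRoot hω hn (by omega) (by omega)]
  split_ifs <;> simp

/-- The average over roots of unity of the truncated Poisson forms is a Toeplitz form. -/
theorem sum_poisson_of_isPrimitiveRoot {M : ℕ} {ω : ℂ} (hω : IsPrimitiveRoot ω M)
    (hn : ‖ω‖ = 1) (T : H →L[ℂ] H) (r s : ℝ) {n N : ℕ} (hN : n ≤ N) (hM : N + n < M) (w : ℕ → H) :
    ∑ i ∈ Finset.range M, ((1 + s) * ‖∑ j ∈ Finset.range n, (ω ^ i) ^ j • w j‖ ^ 2 +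
        ∑ m ∈ Finset.range N, r ^ (m + 1) * (conj (ω ^ i) ^ (m + 1) *
          ⟪∑ j ∈ Finset.range n, (ω ^ i) ^ j • w j,
            (T ^ (m + 1)) (∑ j ∈ Finset.range n, (ω ^ i) ^ j • w j)⟫_ℂ).re) =
      M * (toeplitzForm T r n w + s * ∑ j ∈ Finset.range n, ‖w j‖ ^ 2) := by
  have hnorm : ∑ i ∈ Finset.range M, ‖∑ j ∈ Finset.range n, (ω ^ i) ^ j • w j‖ ^ 2 =
      M * ∑ j ∈ Finset.range n, ‖w j‖ ^ 2 := by
    have h := congrArg Complex.re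
      (sum_conj_pow_mul_inner_of_isPrimitiveRoot hω hn 1 n 0 (by omega) w)
    have hself : ∀ y : H, (⟪y, y⟫_ℂ).re = ‖y‖ ^ 2 := fun y => inner_self_eq_norm_sq (𝕜 := ℂ) y
    simp only [pow_zero, one_mul, one_apply_eq_self, Complex.re_sum, zero_add,
      hself] at h
    rw [h, ← Complex.ofReal_natCast, Complex.re_ofReal_mul, Complex.re_sum]
    congr 1
    refine Finset.sum_congr rfl fun j hj => ?_
    rw [Finset.sum_ite_eq, if_pos hj, hself]
  have hpow : ∀ m ∈ Finset.range N, ∑ i ∈ Finset.range M, r ^ (m + 1) * (conj (ω ^ i) ^ (m + 1) *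
          ⟪∑ j ∈ Finset.range n, (ω ^ i) ^ j • w j,
            (T ^ (m + 1)) (∑ j ∈ Finset.range n, (ω ^ i) ^ j • w j)⟫_ℂ).re =
      M * ∑ j ∈ Finset.range n, ∑ k ∈ Finset.range n,
        if m + 1 + j = k then r ^ (m + 1) * (⟪w j, (T ^ (m + 1)) (w k)⟫_ℂ).re else 0 := by
    intro m hm
    rw [Finset.mem_range] at hm
    have h := congrArg Complex.re
      (sum_conj_pow_mul_inner_of_isPrimitiveRoot hω hn (T ^ (m + 1)) n (m + 1) (by omega) w)
    rw [Complex.re_sum] at h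
    rw [← Finset.mul_sum, h, ← Complex.ofReal_natCast, Complex.re_ofReal_mul, Complex.re_sum, mul_left_comm, Finset.mul_sum]
    congr 1
    refine Finset.sum_congr rfl fun j _ => ?_
    rw [Complex.re_sum, Finset.mul_sum]
    refine Finset.sum_congr rfl fun k _ => ?_
    split_ifs <;> simp
  have hdiag : ∑ m ∈ Finset.range N, ∑ j ∈ Finset.range n, ∑ k ∈ Finset.range n,
        (if m + 1 + j = k then r ^ (m + 1) * (⟪w j, (T ^ (m + 1)) (w k)⟫_ℂ).re else 0) =
      ∑ j ∈ Finset.range n, ∑ k ∈ Finset.range n,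
        if j < k then r ^ (k - j) * (⟪w j, (T ^ (k - j)) (w k)⟫_ℂ).re else 0 := by
    rw [Finset.sum_comm]
    refine Finset.sum_congr rfl fun j _ => ?_
    rw [Finset.sum_comm]
    refine Finset.sum_congr rfl fun k hk => ?_
    rw [Finset.mem_range] at hk
    split_ifs with hjk
    · rw [Finset.sum_eq_single (k - j - 1)]
      · have h1 : k - j - 1 + 1 = k - j := by omega
        rw [h1, if_pos (by omega)]
      · intro m _ hm
        rw [if_neg (by omega)]
      · intro h
        exact absurd (Finset.mem_range.2 (by omega)) h
    · exact Finset.sum_eq_zero fun m _ => if_neg (by omega)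
  rw [Finset.sum_add_distrib, ← Finset.mul_sum, hnorm, Finset.sum_comm,
    Finset.sum_congr rfl hpow, ← Finset.mul_sum, hdiag, toeplitzForm]
  ring

/-- Harnack domination dominates the block Toeplitz forms. -/
theorem HarnackDominated.toeplitzForm_le [CompleteSpace H] {T₁ T₀ : H →L[ℂ] H} (h : HarnackDominated 2 T₁ T₀) :
    ∃ c : ℝ, ∀ (n : ℕ) (w : ℕ → H), toeplitzForm T₁ 1 n w ≤ c * toeplitzForm T₀ 1 n w := by
  obtain ⟨c, -, hc⟩ := (harnackDominated_iff _ _ _).1 h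
  refine ⟨c ^ 2, fun n w => ?_⟩
  obtain ⟨B, hB⟩ : ∃ B : ℝ, B = ∑ j ∈ Finset.range n, ‖w j‖ ^ 2 := ⟨_, rfl⟩
  have key : ∀ r : ℝ, 0 ≤ r → r < 1 → ∀ N : ℕ, n ≤ N →
      toeplitzForm T₁ r n w + 2 * (r ^ (N + 1) / (1 - r)) * B ≤
        c ^ 2 * (toeplitzForm T₀ r n w + 2 * (r ^ (N + 1) / (1 - r)) * B) := by
    intro r hr0 hr1 N hN
    -- Large enough that no two distinct exponents in the averages are congruent mod `M`.
    obtain ⟨M, hM⟩ : ∃ M, M = N + n + 1 := ⟨_, rfl⟩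
    have hω := Complex.isPrimitiveRoot_exp M (by omega)
    obtain ⟨ω, hωdef⟩ : ∃ ω, ω = Complex.exp (2 * Real.pi * Complex.I / M) := ⟨_, rfl⟩
    rw [← hωdef] at hω
    have hn : ‖ω‖ = 1 := hω.norm'_eq_one (by omega)
    have h1 := sum_poisson_of_isPrimitiveRoot hω hn T₁ r (2 * (r ^ (N + 1) / (1 - r))) hN
      (by omega) w
    have h0 := sum_poisson_of_isPrimitiveRoot hω hn T₀ r (2 * (r ^ (N + 1) / (1 - r))) hN
      (by omega) w
    have hMpos : (0 : ℝ) < M := by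
      rw [hM]; positivity
    rw [hB]
    refine le_of_mul_le_mul_left ?_ hMpos
    rw [mul_left_comm, ← h1, ← h0, Finset.mul_sum]
    refine Finset.sum_le_sum fun i _ => ?_
    have hζ : ‖ω ^ i‖ = 1 := by rw [norm_pow, hn, one_pow]
    have h2 := hc _ (poissonPolynomial_re_nonneg hr0 hr1 N hζ)
      (∑ j ∈ Finset.range n, (ω ^ i) ^ j • w j)
    rw [re_inner_aeval_poissonPolynomial, re_inner_aeval_poissonPolynomial,
      re_inner_aeval_poissonPolynomial] at h2
    -- At the zero operator only the constant term survives. For `ρ = 2` it doubles the `‖x‖ ^ 2`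
    -- terms, so both sides become twice the summands of `sum_poisson_of_isPrimitiveRoot`.
    simp only [zero_pow (Nat.succ_ne_zero _), zero_apply, inner_zero_right,
      mul_zero, Complex.zero_re, Finset.sum_const_zero] at h2
    linarith
  have key2 : ∀ r : ℝ, 0 ≤ r → r < 1 →
      toeplitzForm T₁ r n w ≤ c ^ 2 * toeplitzForm T₀ r n w := by
    intro r hr0 hr1
    have hlim : Filter.Tendsto (fun N : ℕ => 2 * (r ^ (N + 1) / (1 - r)) * B) Filter.atTop
        (nhds 0) := by
      have := ((tendsto_pow_atTop_nhds_zero_of_lt_one hr0 hr1).comp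
        (Filter.tendsto_add_atTop_nat 1))
      have := ((this.div_const (1 - r)).const_mul 2).mul_const B
      simpa using this
    have hl := hlim.const_add (toeplitzForm T₁ r n w)
    have hr := (hlim.const_add (toeplitzForm T₀ r n w)).const_mul (c ^ 2)
    rw [add_zero] at hl hr
    exact le_of_tendsto_of_tendsto hl hr
      (Filter.eventually_atTop.2 ⟨n, fun N hN => key r hr0 hr1 N hN⟩)
  have hcont : ∀ T : H →L[ℂ] H, Continuous fun r : ℝ => toeplitzForm T r n w := by
    intro T
    unfold toeplitzForm
    refine continuous_const.add (continuous_finsetSum _ fun j _ =>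
      continuous_finsetSum _ fun k _ => ?_)
    split_ifs <;> fun_prop
  -- The truncation was removed first (`N → ∞` with `r` fixed); now `r → 1` from below.
  have hl := ((hcont T₁).tendsto 1).mono_left (nhdsWithin_le_nhds (s := Set.Iio 1))
  have hr := (((hcont T₀).tendsto 1).const_mul (c ^ 2)).mono_left
    (nhdsWithin_le_nhds (s := Set.Iio 1))
  refine le_of_tendsto_of_tendsto hl hr ?_
  filter_upwards [Ioo_mem_nhdsLT (show (0 : ℝ) < 1 by norm_num)] with r hr
  exact key2 r hr.1.le hr.2

end Harnack

/-! ### Toeplitz forms of operators with a unitary 2-dilation -/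

section Dilation

variable {H : Type*} [NormedAddCommGroup H] [InnerProductSpace ℂ H]

/-- The operator entries of the block Toeplitz matrix of a `2`-contraction. -/
noncomputable def toeplitzEntry [CompleteSpace H] (T : H →L[ℂ] H) (m k : ℕ) : H →L[ℂ] H :=
  if m < k then T ^ (k - m) else if m = k then (2 : ℂ) • 1 else
    (ContinuousLinearMap.adjoint T) ^ (m - k)

theorem norm_sum_sq_eq (n : ℕ) (y : ℕ → H) :
    ‖∑ k ∈ Finset.range n, y k‖ ^ 2 = ∑ j ∈ Finset.range n, ‖y j‖ ^ 2 +
      ∑ j ∈ Finset.range n, ∑ k ∈ Finset.range n,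
        if j < k then 2 * (⟪y j, y k⟫_ℂ).re else 0 := by
  have h1 : ‖∑ k ∈ Finset.range n, y k‖ ^ 2 =
      ∑ j ∈ Finset.range n, ∑ k ∈ Finset.range n, (⟪y j, y k⟫_ℂ).re := by
    rw [← inner_self_eq_norm_sq (𝕜 := ℂ), sum_inner, map_sum]
    refine Finset.sum_congr rfl fun j _ => ?_
    rw [inner_sum, map_sum]
    rfl
  have h2 : ∀ j k, (⟪y j, y k⟫_ℂ).re = (if j = k then ‖y j‖ ^ 2 else 0) +
      ((if j < k then (⟪y j, y k⟫_ℂ).re else 0) + (if k < j then (⟪y k, y j⟫_ℂ).re else 0)) := by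
    intro j k
    have hsymm : (⟪y j, y k⟫_ℂ).re = (⟪y k, y j⟫_ℂ).re := inner_re_symm (𝕜 := ℂ) _ _
    rcases lt_trichotomy j k with h | h | h
    · simp [h, h.ne, h.le]
    · subst h
      have : (⟪y j, y j⟫_ℂ).re = ‖y j‖ ^ 2 := inner_self_eq_norm_sq (𝕜 := ℂ) _
      simp only [lt_irrefl, if_true, if_false, this, add_zero]
    · simp [h, h.ne', h.le, hsymm]
  have h3 : ∑ j ∈ Finset.range n, ∑ k ∈ Finset.range n, (if k < j then (⟪y k, y j⟫_ℂ).re else 0) =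
      ∑ j ∈ Finset.range n, ∑ k ∈ Finset.range n, (if j < k then (⟪y j, y k⟫_ℂ).re else 0) :=
    Finset.sum_comm
  rw [h1]
  rw [Finset.sum_congr rfl fun j _ => Finset.sum_congr rfl fun k _ => h2 j k]
  simp only [Finset.sum_add_distrib]
  rw [h3, ← two_mul, Finset.mul_sum]
  congr 1
  · refine Finset.sum_congr rfl fun j hj => ?_
    rw [Finset.sum_ite_eq, if_pos hj]
  · refine Finset.sum_congr rfl fun j _ => ?_
    rw [Finset.mul_sum]
    refine Finset.sum_congr rfl fun k _ => ?_
    split_ifs <;> simp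

variable [CompleteSpace H] {K : Type*} [NormedAddCommGroup K] [InnerProductSpace ℂ K]
  [CompleteSpace K]

theorem adjoint_pow_mul_pow_of_mem_unitary {U : K →L[ℂ] K} (hU : U ∈ unitary (K →L[ℂ] K))
    (m k : ℕ) : ContinuousLinearMap.adjoint U ^ m * U ^ k =
      if m ≤ k then U ^ (k - m) else ContinuousLinearMap.adjoint U ^ (m - k) := by
  have h : ContinuousLinearMap.adjoint U * U = 1 := Unitary.star_mul_self_of_mem hU
  have hself : ∀ n : ℕ, ContinuousLinearMap.adjoint U ^ n * U ^ n = 1 := by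
    intro n
    induction n with
    | zero => simp
    | succ n ih => rw [pow_succ, pow_succ', mul_assoc, ← mul_assoc _ U, h, one_mul, ih]
  split_ifs with hmk
  · obtain ⟨d, rfl⟩ := Nat.exists_eq_add_of_le hmk
    rw [pow_add, ← mul_assoc, hself, one_mul, Nat.add_sub_cancel_left]
  · obtain ⟨d, rfl⟩ := Nat.exists_eq_add_of_le (not_le.1 hmk).le
    rw [add_comm k d, pow_add, mul_assoc, hself, mul_one, Nat.add_sub_cancel]

/-- The diagonal entry 2 is `2 V† V`, which makes it fit the same formula as the powers of `T` and
of its adjoint. -/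
theorem toeplitzEntry_apply_eq {T : H →L[ℂ] H} {V : H →ₗᵢ[ℂ] K} {U : K →L[ℂ] K}
    (hU : U ∈ unitary (K →L[ℂ] K))
    (hT : ∀ n : ℕ, 1 ≤ n → T ^ n = ((2 : ℝ) : ℂ) •
      (ContinuousLinearMap.adjoint V.toContinuousLinearMap ∘L (U ^ n) ∘L V.toContinuousLinearMap))
    (m k : ℕ) (x : H) :
    toeplitzEntry T m k x = (2 : ℂ) • ContinuousLinearMap.adjoint V.toContinuousLinearMap
      ((ContinuousLinearMap.adjoint U ^ m) ((U ^ k) (V x))) := by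
  rw [← mul_apply_eq_comp, adjoint_pow_mul_pow_of_mem_unitary hU, toeplitzEntry]
  rcases lt_trichotomy m k with h | h | h
  · rw [if_pos h, if_pos h.le, hT _ (by omega)]
    simp
  · subst h
    have hV := congrArg (fun A => A x) (V.toContinuousLinearMap.norm_map_iff_adjoint_comp_self.1
      V.norm_map)
    simp only [ContinuousLinearMap.comp_apply, LinearIsometry.coe_toContinuousLinearMap,
      one_apply_eq_self] at hV
    simp [hV]
  · rw [if_neg (by omega), if_neg (by omega), if_neg (by omega), ← ContinuousLinearMap.star_eq_adjoint,
      ← star_pow, hT _ (by omega), ContinuousLinearMap.star_eq_adjoint, ← ContinuousLinearMap.star_eq_adjoint U,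
      ← star_pow, ContinuousLinearMap.star_eq_adjoint]
    simp [ContinuousLinearMap.adjoint_comp, map_smulₛₗ, Complex.conj_ofNat]

theorem toeplitzForm_eq_norm_sq {T : H →L[ℂ] H} {V : H →ₗᵢ[ℂ] K} {U : K →L[ℂ] K}
    (hU : U ∈ unitary (K →L[ℂ] K))
    (hT : ∀ n : ℕ, 1 ≤ n → T ^ n = ((2 : ℝ) : ℂ) •
      (ContinuousLinearMap.adjoint V.toContinuousLinearMap ∘L (U ^ n) ∘L V.toContinuousLinearMap))
    (n : ℕ) (w : ℕ → H) :
    toeplitzForm T 1 n w = ‖∑ k ∈ Finset.range n, (U ^ k) (V (w k))‖ ^ 2 := by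
  rw [norm_sum_sq_eq, toeplitzForm]
  congr 1
  · refine Finset.sum_congr rfl fun j _ => ?_
    rw [ContinuousLinearMap.norm_map_of_mem_unitary (pow_mem hU j), V.norm_map]
  · refine Finset.sum_congr rfl fun j _ => Finset.sum_congr rfl fun k _ => ?_
    split_ifs with hjk
    · have h := toeplitzEntry_apply_eq hU hT j k (w k)
      rw [toeplitzEntry, if_pos hjk] at h
      rw [h, one_pow, one_mul, inner_smul_right, ContinuousLinearMap.adjoint_inner_right,
        ← ContinuousLinearMap.star_eq_adjoint, ← star_pow, ContinuousLinearMap.star_eq_adjoint,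
        ContinuousLinearMap.adjoint_inner_right]
      simp
    · rfl

/-- If the Toeplitz form of a `2`-contraction is nonpositive at a vector, this vector is in the
kernel of the bilateral block Toeplitz matrix. -/
theorem IsRhoContraction.toeplitz_kernel {H : Type*} [NormedAddCommGroup H]
    [InnerProductSpace ℂ H] [CompleteSpace H] {T : H →L[ℂ] H} (hT : IsRhoContraction 2 T)
    {n : ℕ} {w : ℕ → H} (hw : toeplitzForm T 1 n w ≤ 0) :
    (∀ m, ∑ k ∈ Finset.range n, toeplitzEntry T m k (w k) = 0) ∧
      ∑ k ∈ Finset.range n, (T ^ (k + 1)) (w k) = 0 := by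
  obtain ⟨K, _, _, _, V, U, hU, hVU⟩ := hT
  rw [toeplitzForm_eq_norm_sq hU hVU] at hw
  have h0 : ∑ k ∈ Finset.range n, (U ^ k) (V (w k)) = 0 := by
    rw [← norm_eq_zero, ← sq_eq_zero_iff]
    exact le_antisymm hw (by positivity)
  constructor
  · intro m
    rw [Finset.sum_congr rfl fun k _ => toeplitzEntry_apply_eq hU hVU m k (w k),
      ← Finset.smul_sum, ← map_sum, ← map_sum, h0]
    simp
  · have h1 : ∀ k, (T ^ (k + 1)) (w k) = (2 : ℂ) •
        ContinuousLinearMap.adjoint V.toContinuousLinearMap (U ((U ^ k) (V (w k)))) := by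
      intro k
      rw [hVU _ (by omega), pow_succ']
      simp
    rw [Finset.sum_congr rfl fun k _ => h1 k, ← Finset.smul_sum, ← map_sum, ← map_sum, h0]
    simp

theorem IsRhoContraction.norm_pow_apply_le {H : Type*} [NormedAddCommGroup H]
    [InnerProductSpace ℂ H] [CompleteSpace H] {T : H →L[ℂ] H} (hT : IsRhoContraction 2 T)
    {n : ℕ} (hn : 1 ≤ n) (x : H) : ‖(T ^ n) x‖ ≤ 2 * ‖x‖ := by
  obtain ⟨K, _, _, _, V, U, hU, hVU⟩ := hT
  rw [hVU n hn]
  simp only [smul_apply, ContinuousLinearMap.comp_apply, LinearIsometry.coe_toContinuousLinearMap,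
    norm_smul]
  have h1 : ‖ContinuousLinearMap.adjoint V.toContinuousLinearMap‖ ≤ 1 := by
    rw [LinearIsometryEquiv.norm_map]
    exact V.norm_toContinuousLinearMap_le
  have h2 := (ContinuousLinearMap.adjoint V.toContinuousLinearMap).le_of_opNorm_le h1
    ((U ^ n) (V x))
  rw [ContinuousLinearMap.norm_map_of_mem_unitary (pow_mem hU n), V.norm_map, one_mul] at h2
  have h3 : ‖((2 : ℝ) : ℂ)‖ = 2 := by simp
  rw [h3]
  linarith

end Dilation

/-! ### Positive matrices and Schur products -/

section Gram

open Matrix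
open scoped ComplexOrder

theorem re_dotProduct_star_self {n : Type*} [Fintype n] (x : n → ℂ) :
    (star x ⬝ᵥ x).re = ‖WithLp.toLp 2 x‖ ^ 2 := by
  rw [EuclideanSpace.norm_sq_eq, dotProduct, Complex.re_sum]
  refine Finset.sum_congr rfl fun i _ => ?_
  rw [Pi.star_apply, RCLike.star_def, mul_comm, Complex.mul_conj, Complex.normSq_eq_norm_sq,
    Complex.ofReal_re]

open scoped MatrixOrder in
theorem Matrix.PosSemidef.exists_eq_conjTranspose_mul_self {n : Type*} [Fintype n] [DecidableEq n]
    {A : Matrix n n ℂ} (hA : A.PosSemidef) : ∃ B : Matrix n n ℂ, A = Bᴴ * B :=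
  CStarAlgebra.nonneg_iff_eq_star_mul_self.mp hA.nonneg

/-- Positive semidefinite matrices with comparable kernels are comparable. -/
theorem Matrix.PosSemidef.exists_smul_sub_posSemidef {n : Type*} [Fintype n] [DecidableEq n]
    {A B : Matrix n n ℂ} (hA : A.PosSemidef) (hB : B.PosSemidef)
    (hker : ∀ x, A *ᵥ x = 0 → B *ᵥ x = 0) :
    ∃ c : ℝ, 1 ≤ c ∧ (((c ^ 2 : ℝ) : ℂ) • A - B).PosSemidef := by
  obtain ⟨X, rfl⟩ := hA.exists_eq_conjTranspose_mul_self
  obtain ⟨Y, rfl⟩ := hB.exists_eq_conjTranspose_mul_self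
  have hnorm : ∀ (Z : Matrix n n ℂ) (x : n → ℂ),
      (star x ⬝ᵥ (Zᴴ * Z) *ᵥ x).re = ‖toEuclideanLin Z (WithLp.toLp 2 x)‖ ^ 2 := by
    intro Z x
    rw [← mulVec_mulVec, dotProduct_mulVec, ← star_mulVec, re_dotProduct_star_self]
    rfl
  obtain ⟨f, hf⟩ : ∃ f, f = toEuclideanLin X := ⟨_, rfl⟩
  obtain ⟨g, hg⟩ : ∃ g, g = toEuclideanLin Y := ⟨_, rfl⟩
  have hfg : ∀ x, f x = 0 → g x = 0 := by
    intro x hx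
    have h1 : (Xᴴ * X) *ᵥ x.ofLp = 0 := by
      rw [← mulVec_mulVec]
      have : X *ᵥ x.ofLp = 0 := by
        have := congrArg WithLp.ofLp hx
        rwa [hf] at this
      rw [this, mulVec_zero]
    have h2 := hnorm Y x.ofLp
    rw [hker _ h1, dotProduct_zero, Complex.zero_re, WithLp.toLp_ofLp, ← hg] at h2
    exact norm_eq_zero.1 (pow_eq_zero_iff two_ne_zero |>.1 h2.symm)
  -- As `ker f ⊆ ker g`, the map `g` factors through the range of `f`. The factor is bounded by
  -- finite dimension, whence `‖g x‖ ≤ C ‖f x‖`.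
  obtain ⟨s, hs⟩ := f.rangeRestrict.exists_rightInverse_of_surjective f.range_rangeRestrict
  have hgs : ∀ x, (g ∘ₗ s) (f.rangeRestrict x) = g x := by
    intro x
    rw [← sub_eq_zero, LinearMap.comp_apply, ← map_sub]
    apply hfg
    rw [map_sub, sub_eq_zero]
    have := congrArg Subtype.val (LinearMap.congr_fun hs (f.rangeRestrict x))
    simpa using this
  obtain ⟨C, hC⟩ : ∃ C : ℝ, C = ‖LinearMap.toContinuousLinearMap (g ∘ₗ s)‖ := ⟨_, rfl⟩
  have hC0 : 0 ≤ C := by rw [hC]; positivity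
  have hbound : ∀ x, ‖g x‖ ≤ C * ‖f x‖ := by
    intro x
    rw [← hgs x, hC]
    exact (LinearMap.toContinuousLinearMap (g ∘ₗ s)).le_opNorm (f.rangeRestrict x)
  refine ⟨1 + C, by linarith, ?_⟩
  have hherm : ((((1 + C) ^ 2 : ℝ) : ℂ) • (Xᴴ * X) - Yᴴ * Y).IsHermitian := by
    rw [IsHermitian, conjTranspose_sub, conjTranspose_smul, hA.isHermitian.eq, hB.isHermitian.eq,
      RCLike.star_def, Complex.conj_ofReal]
  refine posSemidef_iff_dotProduct_mulVec.2 ⟨hherm, fun x => ?_⟩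
  rw [Complex.nonneg_iff]
  have him := hherm.im_star_dotProduct_mulVec_self x
  refine ⟨?_, him.symm⟩
  rw [sub_mulVec, smul_mulVec, dotProduct_sub, dotProduct_smul, smul_eq_mul, Complex.sub_re,
    Complex.re_ofReal_mul, hnorm, hnorm, ← hf, ← hg, sub_nonneg]
  have h1 := hbound (WithLp.toLp 2 x)
  have h2 : ‖g (WithLp.toLp 2 x)‖ ≤ (1 + C) * ‖f (WithLp.toLp 2 x)‖ := by
    nlinarith [norm_nonneg (f (WithLp.toLp 2 x))]
  rw [← mul_pow]
  gcongr

/-- The Toeplitz matrix of the harmonic function `2 Re p`. -/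
noncomputable def reToeplitz (p : Polynomial ℂ) (n : ℕ) : Matrix (Fin n) (Fin n) ℂ :=
  Matrix.of fun j k => (if j ≤ k then p.coeff (k - j) else 0) +
    (if k ≤ j then conj (p.coeff (j - k)) else 0)

/-- The entries are Fourier coefficients of `2 Re p`, computed exactly by averaging over enough
roots of unity. The matrix is thus an average of rank-one positive matrices with weights `2 Re p(ω ^
i)`. -/
theorem reToeplitz_posSemidef {p : Polynomial ℂ} (hp : ∀ z : ℂ, ‖z‖ ≤ 1 → 0 ≤ (p.eval z).re)
    (n : ℕ) : (reToeplitz p n).PosSemidef := by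
  obtain ⟨N, hN⟩ : ∃ N, N = p.natDegree + 1 + n := ⟨_, rfl⟩
  obtain ⟨M, hM⟩ : ∃ M, M = N + n + 1 := ⟨_, rfl⟩
  have hω := Complex.isPrimitiveRoot_exp M (by omega)
  obtain ⟨ω, hωdef⟩ : ∃ ω, ω = Complex.exp (2 * Real.pi * Complex.I / M) := ⟨_, rfl⟩
  rw [← hωdef] at hω
  have hn : ‖ω‖ = 1 := hω.norm'_eq_one (by omega)
  have hM0 : (M : ℂ) ≠ 0 := Nat.cast_ne_zero.2 (by omega)
  have hsum : ∀ j k : Fin n, ∑ i ∈ Finset.range M,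
      p.eval (ω ^ i) * ((ω ^ i) ^ (j : ℕ) * conj (ω ^ i) ^ (k : ℕ)) =
        M * if j ≤ k then p.coeff (k - j) else 0 := by
    intro j k
    have h1 : ∀ i, p.eval (ω ^ i) * ((ω ^ i) ^ (j : ℕ) * conj (ω ^ i) ^ (k : ℕ)) =
        ∑ m ∈ Finset.range N,
          p.coeff m * (conj (ω ^ i) ^ (k : ℕ) * (ω ^ i) ^ (m + (j : ℕ))) := by
      intro i
      rw [Polynomial.eval_eq_sum_range' (n := N) (by omega), Finset.sum_mul]
      refine Finset.sum_congr rfl fun m _ => ?_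
      ring
    rw [Finset.sum_congr rfl fun i _ => h1 i, Finset.sum_comm]
    have h2 : ∀ m ∈ Finset.range N, ∑ i ∈ Finset.range M,
          p.coeff m * (conj (ω ^ i) ^ (k : ℕ) * (ω ^ i) ^ (m + (j : ℕ))) =
        if (k : ℕ) = m + j then p.coeff m * M else 0 := by
      intro m hm
      rw [Finset.mem_range] at hm
      rw [← Finset.mul_sum, sum_conj_pow_mul_pow_of_isPrimitiveRoot hω hn (by omega) (by omega)]
      split_ifs <;> simp
    rw [Finset.sum_congr rfl h2]
    split_ifs with hjk
    · have hjk' : (j : ℕ) ≤ k := hjk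
      rw [Finset.sum_eq_single ((k : ℕ) - j)]
      · rw [if_pos (by omega), mul_comm]
      · intro m _ hm
        rw [if_neg (by omega)]
      · intro h
        exact absurd (Finset.mem_range.2 (by omega)) h
    · have hjk' : ¬ (j : ℕ) ≤ k := hjk
      rw [mul_zero]
      exact Finset.sum_eq_zero fun m _ => if_neg (by omega)
  obtain ⟨d, hd⟩ : ∃ d : ℕ → Fin n → ℂ, ∀ i j, d i j = (ω ^ i) ^ (j : ℕ) :=
    ⟨fun i j => (ω ^ i) ^ (j : ℕ), fun _ _ => rfl⟩
  have key : reToeplitz p n = ((M : ℝ)⁻¹ : ℝ) • ∑ i ∈ Finset.range M,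
      (2 * (p.eval (ω ^ i)).re) • vecMulVec (d i) (star (d i)) := by
    ext j k
    have hz : ∀ z : ℂ, ((2 * z.re : ℝ) : ℂ) = z + conj z := by
      intro z
      rw [Complex.add_conj]
    have h1 := hsum j k
    have h2 := congrArg conj (hsum k j)
    rw [map_sum, map_mul, Complex.conj_natCast] at h2
    have h3 : ∀ i, conj (p.eval (ω ^ i) * ((ω ^ i) ^ (k : ℕ) * conj (ω ^ i) ^ (j : ℕ))) =
        conj (p.eval (ω ^ i)) * ((ω ^ i) ^ (j : ℕ) * conj (ω ^ i) ^ (k : ℕ)) := by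
      intro i
      rw [map_mul, map_mul, map_pow _ _ (j : ℕ), Complex.conj_conj, map_pow _ _ (k : ℕ), mul_comm
        (conj (ω ^ i) ^ (k : ℕ))]
    rw [Finset.sum_congr rfl fun i _ => h3 i] at h2
    rw [Matrix.smul_apply, Matrix.sum_apply, reToeplitz, Matrix.of_apply]
    have h4 : ∀ i, ((2 * (p.eval (ω ^ i)).re) • vecMulVec (d i) (star (d i))) j k =
        p.eval (ω ^ i) * ((ω ^ i) ^ (j : ℕ) * conj (ω ^ i) ^ (k : ℕ)) +
        conj (p.eval (ω ^ i)) * ((ω ^ i) ^ (j : ℕ) * conj (ω ^ i) ^ (k : ℕ)) := by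
      intro i
      rw [Matrix.smul_apply, vecMulVec_apply, Complex.real_smul, hz, Pi.star_apply, hd, hd,
        RCLike.star_def, map_pow _ _ (k : ℕ)]
      ring
    rw [Finset.sum_congr rfl fun i _ => h4 i, Finset.sum_add_distrib, h1, h2, Complex.real_smul]
    have h5 : conj (if k ≤ j then p.coeff ((j : ℕ) - k) else 0) =
      if k ≤ j then conj (p.coeff ((j : ℕ) - k)) else 0 := by
      split_ifs <;> simp
    rw [h5, ← mul_add]
    push_cast
    rw [inv_mul_cancel_left₀ hM0]
  rw [key]
  refine PosSemidef.smul (posSemidef_sum _ fun i _ => PosSemidef.smul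
    (posSemidef_vecMulVec_self_star _) ?_) (by positivity)
  have hz : ‖ω ^ i‖ ≤ 1 := by rw [norm_pow, hn, one_pow]
  linarith [hp _ hz]

/-- The powers of `W` sit on the successive diagonals of `Z`. -/
def IsGradedBy {n : ℕ} (W Z : Matrix (Fin n) (Fin n) ℂ) : Prop :=
  ∀ (m : ℕ) (j k : Fin n), (W ^ m) j k = if (j : ℕ) + m = k then Z j k else 0

theorem IsGradedBy.aeval_apply {n : ℕ} {W Z : Matrix (Fin n) (Fin n) ℂ} (h : IsGradedBy W Z)
    (p : Polynomial ℂ) (j k : Fin n) :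
    (Polynomial.aeval W p) j k = if j ≤ k then p.coeff (k - j) * Z j k else 0 := by
  rw [Polynomial.aeval_eq_sum_range' (n := p.natDegree + 1 + n) (by omega), Matrix.sum_apply]
  have h1 : ∀ m : ℕ, (p.coeff m • W ^ m) j k =
      if (j : ℕ) + m = k then p.coeff m * Z j k else 0 := by
    intro m
    rw [Matrix.smul_apply, h m j k, smul_eq_mul]
    split_ifs <;> simp
  rw [Finset.sum_congr rfl fun m _ => h1 m]
  split_ifs with hjk
  · have hjk' : (j : ℕ) ≤ k := hjk
    rw [Finset.sum_eq_single ((k : ℕ) - j)]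
    · rw [if_pos (by omega)]
    · intro m _ hm
      rw [if_neg (by omega)]
    · intro hm
      exact absurd (Finset.mem_range.2 (by omega)) hm
  · have hjk' : ¬ (j : ℕ) ≤ k := hjk
    exact Finset.sum_eq_zero fun m _ => if_neg (by omega)

theorem IsGradedBy.diag {n : ℕ} {W Z : Matrix (Fin n) (Fin n) ℂ} (h : IsGradedBy W Z)
    (j : Fin n) : Z j j = 1 := by
  have := h 0 j j
  simpa using this.symm

/-- Off the diagonal, multiplying the superdiagonals of `Z` by the coefficients of `p` assembles
`p(W)`. The diagonal of `Z + Zᴴ` is 2, so the constant term is counted twice; the surplus is exactly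
the `Re p(0)` term of domination for `ρ = 2`. -/
theorem IsGradedBy.hadamard_reToeplitz {n : ℕ} {W Z : Matrix (Fin n) (Fin n) ℂ}
    (h : IsGradedBy W Z) (hZ : ∀ j k, k < j → Z j k = 0) (p : Polynomial ℂ) :
    Matrix.hadamard (Z + Zᴴ) (reToeplitz p n) =
      Polynomial.aeval W p + (Polynomial.aeval W p)ᴴ +
        (p.coeff 0 + conj (p.coeff 0)) • (1 : Matrix (Fin n) (Fin n) ℂ) := by
  ext j k
  rw [Matrix.hadamard_apply, Matrix.add_apply, Matrix.add_apply, Matrix.add_apply,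
    conjTranspose_apply, conjTranspose_apply, h.aeval_apply, h.aeval_apply, reToeplitz,
    Matrix.of_apply, Matrix.smul_apply]
  rcases lt_trichotomy j k with hjk | rfl | hjk
  · simp [hjk.le, hjk.not_ge, hjk.ne, hZ k j hjk, mul_comm]
  · simp only [le_refl, if_true, h.diag, Nat.sub_self, Matrix.one_apply_eq]
    simp
    ring
  · simp [hjk.le, hjk.not_ge, hjk.ne', hZ j k hjk, mul_comm]

end Gram

/-! ### Domination and dilations from Gram matrices -/

section MatrixOperators

open Matrix
open scoped ComplexOrder

theorem inner_matOp (A : Matrix (Fin 5) (Fin 5) ℂ) (x y : EuclideanSpace ℂ (Fin 5)) :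
    ⟪x, matOp A y⟫_ℂ = star x.ofLp ⬝ᵥ (A *ᵥ y.ofLp) := by
  rw [EuclideanSpace.inner_eq_star_dotProduct, dotProduct_comm]
  rfl

theorem matOp_pow (A : Matrix (Fin 5) (Fin 5) ℂ) (n : ℕ) : matOp A ^ n = matOp (A ^ n) :=
  (map_pow (Matrix.toEuclideanCLM (𝕜 := ℂ) (n := Fin 5)) A n).symm

theorem aeval_matOp (A : Matrix (Fin 5) (Fin 5) ℂ) (p : Polynomial ℂ) :
    Polynomial.aeval (matOp A) p = matOp (Polynomial.aeval A p) :=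
  Polynomial.aeval_algHom_apply
    ((Matrix.toEuclideanCLM (𝕜 := ℂ) (n := Fin 5)) : _ ≃⋆ₐ[ℂ] _).toAlgEquiv.toAlgHom A p

theorem adjoint_matOp (A : Matrix (Fin 5) (Fin 5) ℂ) :
    ContinuousLinearMap.adjoint (matOp A) = matOp Aᴴ :=
  (map_star (Matrix.toEuclideanCLM (𝕜 := ℂ) (n := Fin 5)) A).symm

theorem re_star_dotProduct_conjTranspose_mulVec (A : Matrix (Fin 5) (Fin 5) ℂ) (x : Fin 5 → ℂ) :
    (star x ⬝ᵥ (Aᴴ *ᵥ x)).re = (star x ⬝ᵥ (A *ᵥ x)).re := by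
  have : star x ⬝ᵥ (Aᴴ *ᵥ x) = star (star x ⬝ᵥ (A *ᵥ x)) := by
    rw [dotProduct_mulVec, ← star_mulVec, star_dotProduct]
  rw [this]
  exact Complex.conj_re _

theorem harnackDominated_of_gram {W₁ Z₁ W₀ Z₀ : Matrix (Fin 5) (Fin 5) ℂ}
    (h₁ : IsGradedBy W₁ Z₁) (hZ₁ : ∀ j k, k < j → Z₁ j k = 0)
    (h₀ : IsGradedBy W₀ Z₀) (hZ₀ : ∀ j k, k < j → Z₀ j k = 0)
    (hG₁ : (Z₁ + Z₁ᴴ).PosSemidef) (hG₀ : (Z₀ + Z₀ᴴ).PosSemidef)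
    (hker : ∀ x, (Z₀ + Z₀ᴴ) *ᵥ x = 0 → (Z₁ + Z₁ᴴ) *ᵥ x = 0) :
    HarnackDominated 2 (matOp W₁) (matOp W₀) := by
  rw [harnackDominated_iff]
  obtain ⟨c, hc, hD⟩ := hG₀.exists_smul_sub_posSemidef hG₁ hker
  refine ⟨c, hc, fun p hp x => ?_⟩
  -- Schur product theorem: one comparison of Gram matrices serves all `p` with the same `c`.
  have hH := hD.hadamard (reToeplitz_posSemidef hp 5)
  have hsplit : hadamard (((c ^ 2 : ℝ) : ℂ) • (Z₀ + Z₀ᴴ) - (Z₁ + Z₁ᴴ)) (reToeplitz p 5) =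
      ((c ^ 2 : ℝ) : ℂ) • hadamard (Z₀ + Z₀ᴴ) (reToeplitz p 5) -
        hadamard (Z₁ + Z₁ᴴ) (reToeplitz p 5) := by
    ext j k
    simp only [hadamard_apply, Matrix.sub_apply, Matrix.smul_apply, smul_eq_mul]
    ring
  rw [hsplit, h₁.hadamard_reToeplitz hZ₁, h₀.hadamard_reToeplitz hZ₀] at hH
  have h := (Complex.nonneg_iff.1 (hH.dotProduct_mulVec_nonneg x.ofLp)).1
  have hz : ((Polynomial.aeval (0 : EuclideanSpace ℂ (Fin 5) →L[ℂ] EuclideanSpace ℂ (Fin 5)) p) x) =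
      p.coeff 0 • x := by
    rw [← Polynomial.coeff_zero_eq_aeval_zero' p, Algebra.algebraMap_eq_smul_one, _root_.smul_apply,
      one_apply_eq_self]
  rw [aeval_matOp, aeval_matOp, inner_matOp, inner_matOp, hz, inner_smul_right]
  have ha : p.coeff 0 + conj (p.coeff 0) = ((2 * (p.coeff 0).re : ℝ) : ℂ) := by
    rw [Complex.add_conj]
  have hxx : ⟪x, x⟫_ℂ = ((‖x‖ ^ 2 : ℝ) : ℂ) := by
    rw [inner_self_eq_norm_sq_to_K]; norm_cast
  have hx : (star x.ofLp ⬝ᵥ x.ofLp) = ((‖x‖ ^ 2 : ℝ) : ℂ) := by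
    rw [dotProduct_comm, ← EuclideanSpace.inner_eq_star_dotProduct, hxx]
  rw [ha] at h
  simp only [sub_mulVec, smul_mulVec, add_mulVec, one_mulVec, dotProduct_sub, dotProduct_smul,
    dotProduct_add, smul_eq_mul, Complex.sub_re, Complex.re_ofReal_mul, Complex.add_re,
    re_star_dotProduct_conjTranspose_mulVec, hx, Complex.ofReal_re] at h
  rw [hxx, Complex.re_mul_ofReal]
  linarith

/-- The bilateral shift on an orthonormal basis indexed by `ℤ × κ`. -/
theorem exists_unitary_shift {κ K : Type*} [NormedAddCommGroup K] [InnerProductSpace ℂ K]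
    [CompleteSpace K] (b : HilbertBasis (ℤ × κ) ℂ K) :
    ∃ U ∈ unitary (K →L[ℂ] K), ∀ (n : ℕ) (z : ℤ) (i : κ), (U ^ n) (b (z, i)) = b (z - n, i) := by
  obtain ⟨e, he⟩ : ∃ e : (ℤ × κ) ≃ (ℤ × κ), ∀ z i, e (z, i) = (z - 1, i) :=
    ⟨(Equiv.subRight (1 : ℤ)).prodCongr (Equiv.refl κ), fun _ _ => rfl⟩
  have horth : Orthonormal ℂ (b ∘ e) := b.orthonormal.comp e e.injective
  have hdense : ⊤ ≤ (Submodule.span ℂ (Set.range (b ∘ e))).topologicalClosure := by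
    rw [Set.range_comp, e.range_eq_univ, Set.image_univ, b.dense_span]
  obtain ⟨b', hb'⟩ : ∃ b' : HilbertBasis (ℤ × κ) ℂ K, ⇑b' = b ∘ e :=
    ⟨HilbertBasis.mk horth hdense, HilbertBasis.coe_mk horth hdense⟩
  refine ⟨Unitary.linearIsometryEquiv.symm (b.repr.trans b'.repr.symm), SetLike.coe_mem _, ?_⟩
  intro n
  induction n with
  | zero => intro z i; simp
  | succ n ih =>
    intro z i
    rw [pow_succ, mul_apply_eq_comp]
    have : ((Unitary.linearIsometryEquiv.symm (b.repr.trans b'.repr.symm) :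
        unitary (K →L[ℂ] K)) : K →L[ℂ] K) (b (z, i)) = b (z - 1, i) := by
      classical
      change b'.repr.symm (b.repr (b (z, i))) = _
      rw [b.repr_self, b'.repr_symm_single, hb', Function.comp_apply, he]
    rw [this, ih]
    push_cast
    congr 2
    ring

/-- Factor `Z + Zᴴ = Bᴴ B` and put column `k` of `B`, divided by `√2`, in layer `k` of the bilateral
shift space. The shift lowers layers by one, so `U ^ n v k` meets `v j` only when `j + n = k`, with
inner product half the Gram entry. The diagonal value 2 makes these vectors orthonormal. -/
theorem isRhoContraction_of_gram {W Z : Matrix (Fin 5) (Fin 5) ℂ}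
    (h : IsGradedBy W Z) (hZ : ∀ j k, k < j → Z j k = 0) (hG : (Z + Zᴴ).PosSemidef) :
    IsRhoContraction 2 (matOp W) := by
  obtain ⟨B, hB⟩ := hG.exists_eq_conjTranspose_mul_self
  obtain ⟨b⟩ : Nonempty (HilbertBasis (ℤ × Fin 5) ℂ (lp (fun _ : ℤ × Fin 5 => ℂ) 2)) :=
    ⟨HilbertBasis.ofRepr (LinearIsometryEquiv.refl ℂ _)⟩
  obtain ⟨U, hU, hUb⟩ := exists_unitary_shift b
  obtain ⟨s, hs⟩ : ∃ s : ℂ, s = ((Real.sqrt 2)⁻¹ : ℝ) := ⟨_, rfl⟩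
  have hss : conj s * s = 1 / 2 := by
    rw [hs, Complex.conj_ofReal, ← Complex.ofReal_mul, ← mul_inv, Real.mul_self_sqrt (by norm_num)]
    norm_num
  obtain ⟨v, hv⟩ : ∃ v : Fin 5 → lp (fun _ : ℤ × Fin 5 => ℂ) 2,
      ∀ k, v k = ∑ i, (s * B i k) • b ((k : ℤ), i) :=
    ⟨fun k => ∑ i, (s * B i k) • b ((k : ℤ), i), fun _ => rfl⟩
  have hbb : ∀ (y z : ℤ) (i j : Fin 5), ⟪b (y, i), b (z, j)⟫_ℂ =
      if y = z ∧ i = j then 1 else 0 := by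
    intro y z i j
    rw [orthonormal_iff_ite.1 b.orthonormal]
    simp only [Prod.mk.injEq]
  have hinner : ∀ (n : ℕ) (j k : Fin 5), ⟪v j, (U ^ n) (v k)⟫_ℂ =
      if (j : ℕ) + n = k then (Z + Zᴴ) j k / 2 else 0 := by
    intro n j k
    rw [hv, hv, map_sum, sum_inner]
    simp only [inner_sum, map_smul, inner_smul_left, inner_smul_right, hUb, hbb]
    have hiff : ((j : ℕ) : ℤ) = ((k : ℕ) : ℤ) - n ↔ (j : ℕ) + n = k := by omega
    simp only [hiff]
    split_ifs with hjk
    · simp only [hjk, true_and, mul_ite, mul_one, mul_zero, Finset.sum_ite_eq, Finset.mem_univ,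
        if_true]
      rw [hB, mul_apply, Finset.sum_div]
      refine Finset.sum_congr rfl fun i _ => ?_
      rw [conjTranspose_apply, RCLike.star_def, map_mul]
      linear_combination (conj (B i j) * B i k) * hss
    · simp [hjk]
  have hvo : Orthonormal ℂ v := by
    rw [orthonormal_iff_ite]
    intro j k
    have h1 := hinner 0 j k
    rw [pow_zero, one_apply_eq_self, add_zero] at h1
    rw [h1]
    by_cases hjk : j = k
    · subst hjk
      rw [if_pos rfl, if_pos rfl, Matrix.add_apply, conjTranspose_apply, h.diag, star_one]
      norm_num
    · rw [if_neg (fun h => hjk (Fin.ext h)), if_neg hjk]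
  obtain ⟨e, he⟩ : ∃ e, e = EuclideanSpace.basisFun (Fin 5) ℂ := ⟨_, rfl⟩
  obtain ⟨f, hf⟩ : ∃ f, f = e.toBasis.constr ℂ v := ⟨_, rfl⟩
  have hfv : f ∘ e.toBasis = v := by
    funext k
    rw [hf, Function.comp_apply, Module.Basis.constr_basis]
  have heo : Orthonormal ℂ e.toBasis := by
    rw [e.coe_toBasis]
    exact e.orthonormal
  have hfo : Orthonormal ℂ (f ∘ e.toBasis) := by rwa [hfv]
  have hVk : ∀ k, f.isometryOfOrthonormal heo hfo (e k) = v k := by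
    intro k
    rw [LinearMap.coe_isometryOfOrthonormal, ← e.coe_toBasis, ← congrFun hfv k, Function.comp_apply]
  refine ⟨lp (fun _ : ℤ × Fin 5 => ℂ) 2, inferInstance, inferInstance, inferInstance,
    f.isometryOfOrthonormal heo hfo, U, hU, ?_⟩
  intro n hn
  obtain ⟨V, hV⟩ : ∃ V, V = f.isometryOfOrthonormal heo hfo := ⟨_, rfl⟩
  rw [← hV] at hVk ⊢
  apply ContinuousLinearMap.coe_injective
  apply e.toBasis.ext
  intro k
  refine InnerProductSpace.ext_inner_left_basis e.toBasis fun j => ?_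
  rw [e.coe_toBasis]
  simp only [ContinuousLinearMap.coe_coe, _root_.smul_apply, ContinuousLinearMap.comp_apply,
    inner_smul_right, ContinuousLinearMap.adjoint_inner_right,
    LinearIsometry.coe_toContinuousLinearMap]
  rw [hVk, hVk, hinner, matOp_pow, inner_matOp]
  have hjk : star (e j).ofLp ⬝ᵥ ((W ^ n) *ᵥ (e k).ofLp) = (W ^ n) j k := by
    rw [he]
    simp [EuclideanSpace.basisFun_apply]
  rw [hjk, h n j k]
  split_ifs with hc
  · have hlt : j < k := Fin.lt_def.2 (by omega)
    rw [Matrix.add_apply, conjTranspose_apply, hZ k j hlt, star_zero, add_zero]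
    push_cast
    ring
  · simp

end MatrixOperators

/-! ### Gram matrices of weighted shifts -/

section WeightedShift

open Matrix
open scoped ComplexOrder

/-- The weighted shift of size five with weights `w`. -/
def weightedShift (w : Fin 4 → ℂ) : Matrix (Fin 5) (Fin 5) ℂ :=
  !![0, w 0, 0, 0, 0;
     0, 0, w 1, 0, 0;
     0, 0, 0, w 2, 0;
     0, 0, 0, 0, w 3;
     0, 0, 0, 0, 0]

/-- The sum of the powers of `weightedShift w`. -/
def weightedShiftSum (w : Fin 4 → ℂ) : Matrix (Fin 5) (Fin 5) ℂ :=
  !![1, w 0, w 0 * w 1, w 0 * w 1 * w 2, w 0 * w 1 * w 2 * w 3;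
     0, 1, w 1, w 1 * w 2, w 1 * w 2 * w 3;
     0, 0, 1, w 2, w 2 * w 3;
     0, 0, 0, 1, w 3;
     0, 0, 0, 0, 1]

theorem weightedShiftSum_apply_of_lt (w : Fin 4 → ℂ) (j k : Fin 5) (h : k < j) :
    weightedShiftSum w j k = 0 := by
  fin_cases j <;> fin_cases k <;> first | rfl | simp at h

theorem isGradedBy_weightedShift (w : Fin 4 → ℂ) :
    IsGradedBy (weightedShift w) (weightedShiftSum w) := by
  have h2 : weightedShift w ^ 2 =
      !![0, 0, w 0 * w 1, 0, 0; 0, 0, 0, w 1 * w 2, 0; 0, 0, 0, 0, w 2 * w 3;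
         0, 0, 0, 0, 0; 0, 0, 0, 0, 0] := by
    rw [pow_two, weightedShift]
    ext i j
    fin_cases i <;> fin_cases j <;> simp [Matrix.mul_apply, Fin.sum_univ_five]
  have h3 : weightedShift w ^ 3 =
      !![0, 0, 0, w 0 * w 1 * w 2, 0; 0, 0, 0, 0, w 1 * w 2 * w 3; 0, 0, 0, 0, 0;
         0, 0, 0, 0, 0; 0, 0, 0, 0, 0] := by
    rw [pow_succ, h2, weightedShift]
    ext i j
    fin_cases i <;> fin_cases j <;> simp [Matrix.mul_apply, Fin.sum_univ_five]
  have h4 : weightedShift w ^ 4 =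
      !![0, 0, 0, 0, w 0 * w 1 * w 2 * w 3; 0, 0, 0, 0, 0; 0, 0, 0, 0, 0;
         0, 0, 0, 0, 0; 0, 0, 0, 0, 0] := by
    rw [pow_succ, h3, weightedShift]
    ext i j
    fin_cases i <;> fin_cases j <;> simp [Matrix.mul_apply, Fin.sum_univ_five]
  have h5 : weightedShift w ^ 5 = 0 := by
    rw [pow_succ, h4, weightedShift]
    ext i j
    fin_cases i <;> fin_cases j <;> simp [Matrix.mul_apply, Fin.sum_univ_five]
  intro m j k
  rcases lt_or_ge m 5 with hm | hm
  · interval_cases m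
    · rw [pow_zero, weightedShiftSum]
      fin_cases j <;> fin_cases k <;> simp
    · rw [pow_one, weightedShiftSum, weightedShift]
      fin_cases j <;> fin_cases k <;> simp
    · rw [h2, weightedShiftSum]
      fin_cases j <;> fin_cases k <;> simp
    · rw [h3, weightedShiftSum]
      fin_cases j <;> fin_cases k <;> simp
    · rw [h4, weightedShiftSum]
      fin_cases j <;> fin_cases k <;> simp
  · obtain ⟨d, rfl⟩ := Nat.exists_eq_add_of_le hm
    rw [pow_add, h5, zero_mul, if_neg (by omega)]
    rfl

theorem weightedShiftSum_mul (w : Fin 4 → ℂ) :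
    weightedShiftSum w * (1 - weightedShift w) = 1 := by
  rw [weightedShiftSum, weightedShift]
  ext i j
  fin_cases i <;> fin_cases j <;> simp [Matrix.mul_apply, Fin.sum_univ_five, Matrix.one_apply]

/-- The vector spanning the kernel of the Gram matrix of a weighted shift with pivots `d`. -/
noncomputable def weightedShiftKernel (w : Fin 4 → ℂ) (d : Fin 4 → ℝ) : Fin 5 → ℂ :=
  ![(w 0 / d 0 - w 0) * (w 1 / d 1 * (w 2 / d 2 * (w 3 / d 3))),
    (w 1 / d 1 - w 1) * (w 2 / d 2 * (w 3 / d 3)),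
    (w 2 / d 2 - w 2) * (w 3 / d 3),
    w 3 / d 3 - w 3,
    1]

/-- Since `Z = (1 - W)⁻¹`, the matrix `Z + Zᴴ` is congruent through `Z` to the tridiagonal `(1 - W)
+ (1 - W)ᴴ`, whose elimination pivots are the `d k`. The last hypothesis says that the fifth pivot
vanishes, so the kernel is a line. -/
theorem weightedShift_gram {w : Fin 4 → ℂ} {d : Fin 4 → ℝ} (hd : ∀ k, 0 < d k)
    (h0 : d 0 = 2) (h1 : d 1 + Complex.normSq (w 0) / d 0 = 2)
    (h2 : d 2 + Complex.normSq (w 1) / d 1 = 2) (h3 : d 3 + Complex.normSq (w 2) / d 2 = 2)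
    (h4 : Complex.normSq (w 3) / d 3 = 2) :
    (weightedShiftSum w + (weightedShiftSum w)ᴴ).PosSemidef ∧
      ∀ x, (weightedShiftSum w + (weightedShiftSum w)ᴴ) *ᵥ x = 0 ↔
        x = x 4 • weightedShiftKernel w d := by
  obtain ⟨a, ha⟩ : ∃ a : Fin 4 → ℝ, ∀ k, a k = Real.sqrt (d k) := ⟨_, fun _ => rfl⟩
  have ha0 : ∀ k, (a k : ℂ) ≠ 0 := fun k => by
    rw [ha]; exact_mod_cast (Real.sqrt_pos.2 (hd k)).ne'
  have haa : ∀ k, (a k : ℂ) * a k = d k := fun k => by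
    rw [ha, ← Complex.ofReal_mul, Real.mul_self_sqrt (hd k).le]
  have hww : ∀ k, conj (w k) / a k * (w k / a k) = ((Complex.normSq (w k) / d k : ℝ) : ℂ) := by
    intro k
    rw [div_mul_div_comm, haa, mul_comm, Complex.mul_conj, Complex.ofReal_div]
  -- The bidiagonal Cholesky factor, with only four rows because the fifth pivot is zero. Its kernel
  -- solves `y k = (w k / d k) y (k + 1)`, and `x = (1 - W) y`.
  obtain ⟨C, hC⟩ : ∃ C : Matrix (Fin 4) (Fin 5) ℂ, C =
      !![(a 0 : ℂ), -(w 0 / a 0), 0, 0, 0; 0, (a 1 : ℂ), -(w 1 / a 1), 0, 0;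
         0, 0, (a 2 : ℂ), -(w 2 / a 2), 0; 0, 0, 0, (a 3 : ℂ), -(w 3 / a 3)] := ⟨_, rfl⟩
  have e0 : (a 0 : ℂ) * a 0 = 2 := by rw [haa, h0]; norm_num
  have e1 : conj (w 0) / a 0 * (w 0 / a 0) + (a 1 : ℂ) * a 1 = 2 := by
    rw [haa, hww, ← Complex.ofReal_add, add_comm, h1]; norm_num
  have e2 : conj (w 1) / a 1 * (w 1 / a 1) + (a 2 : ℂ) * a 2 = 2 := by
    rw [haa, hww, ← Complex.ofReal_add, add_comm, h2]; norm_num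
  have e3 : conj (w 2) / a 2 * (w 2 / a 2) + (a 3 : ℂ) * a 3 = 2 := by
    rw [haa, hww, ← Complex.ofReal_add, add_comm, h3]; norm_num
  have e4 : conj (w 3) / a 3 * (w 3 / a 3) = 2 := by
    rw [hww, h4]; norm_num
  have hCC : Cᴴ * C = (1 - weightedShift w) + (1 - weightedShift w)ᴴ := by
    rw [hC, weightedShift]
    have c1 : ∀ k, (a k : ℂ) * (w k / a k) = w k := fun k => mul_div_cancel₀ _ (ha0 k)
    have c2 : ∀ k, conj (w k) / (a k : ℂ) * a k = conj (w k) := fun k => div_mul_cancel₀ _ (ha0 k)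
    ext i j
    fin_cases i <;> fin_cases j <;>
      simp [Matrix.mul_apply, Fin.sum_univ_four, c1, c2, e0, e1, e2, e3, e4] <;>
      norm_num
  have hZ := weightedShiftSum_mul w
  have hZ' := mul_eq_one_comm.1 hZ
  have hZs : (weightedShiftSum w)ᴴ * (1 - weightedShift w)ᴴ = 1 := by
    rw [← conjTranspose_mul, hZ', conjTranspose_one]
  have hG : weightedShiftSum w + (weightedShiftSum w)ᴴ =
      (C * weightedShiftSum w)ᴴ * (C * weightedShiftSum w) := by
    rw [conjTranspose_mul, Matrix.mul_assoc, ← Matrix.mul_assoc Cᴴ, hCC, add_mul, hZ', mul_add,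
      ← Matrix.mul_assoc, hZs, Matrix.mul_one, Matrix.one_mul, add_comm]
  rw [hG]
  refine ⟨posSemidef_conjTranspose_mul_self _, fun x => ?_⟩
  rw [conjTranspose_mul_self_mulVec_eq_zero, ← mulVec_mulVec]
  obtain ⟨y, hy⟩ : ∃ y, y = weightedShiftSum w *ᵥ x := ⟨_, rfl⟩
  have hx : x = (1 - weightedShift w) *ᵥ y := by
    rw [hy, mulVec_mulVec, hZ', one_mulVec]
  rw [← hy, hx]
  have hdiv : ∀ k, (w k / a k) = a k * (w k / d k) := fun k => by
    rw [← haa]; field_simp [ha0 k]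
  have hCy : C *ᵥ y = ![a 0 * (y 0 - w 0 / d 0 * y 1), a 1 * (y 1 - w 1 / d 1 * y 2),
      a 2 * (y 2 - w 2 / d 2 * y 3), a 3 * (y 3 - w 3 / d 3 * y 4)] := by
    rw [hC]
    funext i
    fin_cases i <;> simp [mulVec, dotProduct, Fin.sum_univ_five, hdiv] <;> ring
  have hWy : (1 - weightedShift w) *ᵥ y = ![y 0 - w 0 * y 1, y 1 - w 1 * y 2, y 2 - w 2 * y 3,
      y 3 - w 3 * y 4, y 4] := by
    rw [weightedShift]
    funext i
    fin_cases i <;> simp [mulVec, dotProduct, Fin.sum_univ_five, Matrix.one_apply] <;> ring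
  rw [hCy, hWy, weightedShiftKernel]
  constructor
  · intro h
    have g0 := congrFun h 0
    have g1 := congrFun h 1
    have g2 := congrFun h 2
    have g3 := congrFun h 3
    simp [ha0, sub_eq_zero] at g0 g1 g2 g3
    funext i
    fin_cases i <;> simp [g0, g1, g2, g3] <;> ring
  · intro h
    have g0 := congrFun h 0
    have g1 := congrFun h 1
    have g2 := congrFun h 2
    have g3 := congrFun h 3
    simp at g0 g1 g2 g3
    have f3 : y 3 = w 3 / d 3 * y 4 := by linear_combination g3
    have f2 : y 2 = w 2 / d 2 * y 3 := by linear_combination g2 + (w 2 - w 2 / d 2) * f3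
    have f1 : y 1 = w 1 / d 1 * y 2 := by
      linear_combination g1 + (w 1 - w 1 / d 1) * (f2 + w 2 / d 2 * f3)
    have f0 : y 0 = w 0 / d 0 * y 1 := by
      linear_combination g0 + (w 0 - w 0 / d 0) * (f1 + w 1 / d 1 * (f2 + w 2 / d 2 * f3))
    funext i
    fin_cases i <;> simp [ha0, sub_eq_zero]
    · exact f0
    · exact f1
    · exact f2
    · exact f3

end WeightedShift

/-! ### The two families and their common kernel -/

section Families

open Matrix
open scoped ComplexOrder

/-- The vectors `x k • e k` of `ℂ⁵`, indexed by `ℕ`. -/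
noncomputable def coordinateVectors (x : Fin 5 → ℂ) (k : ℕ) : EuclideanSpace ℂ (Fin 5) :=
  if h : k < 5 then EuclideanSpace.single ⟨k, h⟩ (x ⟨k, h⟩) else 0

theorem coordinateVectors_apply (x : Fin 5 → ℂ) (k : Fin 5) :
    coordinateVectors x k = EuclideanSpace.single k (x k) := by
  simp [coordinateVectors]

/-- At the vectors `x k • e k` only the entries `(W ^ (k - j)) j k = Z j k` are seen, so the block
form collapses to the scalar Gram form. -/
theorem toeplitzForm_of_isGradedBy {W Z : Matrix (Fin 5) (Fin 5) ℂ}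
    (h : IsGradedBy W Z) (hZ : ∀ j k, k < j → Z j k = 0) (x : Fin 5 → ℂ) :
    2 * toeplitzForm (matOp W) 1 5 (coordinateVectors x) = (star x ⬝ᵥ (Z + Zᴴ) *ᵥ x).re := by
  rw [add_mulVec, dotProduct_add, Complex.add_re, re_star_dotProduct_conjTranspose_mulVec,
    ← two_mul, toeplitzForm]
  congr 1
  simp only [Finset.sum_range, coordinateVectors_apply, dotProduct, mulVec, Finset.mul_sum,
    Complex.re_sum]
  rw [← Finset.sum_add_distrib]
  refine Finset.sum_congr rfl fun j _ => ?_
  have h1 : ∀ k, (star x j * (Z j k * x k)).re = (if j = k then ‖x j‖ ^ 2 else 0) +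
      if (j : ℕ) < k then (1 : ℝ) ^ ((k : ℕ) - j) * (⟪EuclideanSpace.single j (x j),
        (matOp W ^ ((k : ℕ) - j)) (EuclideanSpace.single k (x k))⟫_ℂ).re else 0 := by
    intro k
    rcases lt_trichotomy j k with hjk | rfl | hjk
    · have hjk' : (j : ℕ) < k := hjk
      rw [if_neg hjk.ne, if_pos hjk', zero_add, one_pow, one_mul, matOp_pow, inner_matOp]
      congr 1
      have := h ((k : ℕ) - j) j k
      rw [if_pos (by omega)] at this
      simp [this]
      ring
    · rw [if_pos rfl, if_neg (lt_irrefl _), add_zero, h.diag, one_mul, Pi.star_apply,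
        RCLike.star_def, mul_comm, Complex.mul_conj, Complex.normSq_eq_norm_sq, Complex.ofReal_re]
    · have hjk' : ¬ (j : ℕ) < k := not_lt.2 (le_of_lt hjk)
      rw [hZ j k hjk, if_neg hjk.ne', if_neg hjk']
      simp
  rw [Finset.sum_congr rfl fun k _ => h1 k, Finset.sum_add_distrib, Finset.sum_ite_eq,
    if_pos (Finset.mem_univ _)]
  simp

/-- The Gram matrix of the weighted shift is positive semidefinite with kernel spanned by `c`. -/
def HasGramKernel (w : Fin 4 → ℂ) (c : Fin 5 → ℂ) : Prop :=
  (weightedShiftSum w + (weightedShiftSum w)ᴴ).PosSemidef ∧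
    ∀ x, (weightedShiftSum w + (weightedShiftSum w)ᴴ) *ᵥ x = 0 ↔ x = x 4 • c

theorem HasGramKernel.mem_harnackPart {w₁ w₀ : Fin 4 → ℂ} {c : Fin 5 → ℂ}
    (h₁ : HasGramKernel w₁ c) (h₀ : HasGramKernel w₀ c) :
    matOp (weightedShift w₁) ∈ harnackPart 2 (matOp (weightedShift w₀)) := by
  have g := isGradedBy_weightedShift
  have z := weightedShiftSum_apply_of_lt
  exact ⟨isRhoContraction_of_gram (g w₁) (z w₁) h₁.1, isRhoContraction_of_gram (g w₀) (z w₀) h₀.1,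
    harnackDominated_of_gram (g w₁) (z w₁) (g w₀) (z w₀) h₁.1 h₀.1
      fun x hx => (h₁.2 x).2 ((h₀.2 x).1 hx),
    harnackDominated_of_gram (g w₀) (z w₀) (g w₁) (z w₁) h₀.1 h₁.1
      fun x hx => (h₀.2 x).2 ((h₁.2 x).1 hx)⟩

/-- The common kernel vector of the two families, at `z = 1`. -/
noncomputable def familyKernel : Fin 5 → ℂ :=
  ![-1, -((1 / Real.sqrt 3 : ℝ) : ℂ), 0, ((1 / Real.sqrt 3 : ℝ) : ℂ), 1]

/-- The weights of the first family. -/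
noncomputable def weightsOne (θ : ℝ) : Fin 4 → ℂ :=
  ![((2 / Real.sqrt 3 : ℝ) : ℂ), ((2 / Real.sqrt 3 : ℝ) : ℂ) * Complex.exp (Complex.I * θ),
    ((2 / Real.sqrt 3 : ℝ) : ℂ) * Complex.exp (-(Complex.I * θ)), ((2 / Real.sqrt 3 : ℝ) : ℂ)]

/-- The weights of the second family. -/
noncomputable def weightsTwo (θ : ℝ) : Fin 4 → ℂ :=
  ![-((Real.sqrt 3 : ℝ) : ℂ), ((1 / Real.sqrt 2 : ℝ) : ℂ) * Complex.exp (Complex.I * θ),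
    ((1 / Real.sqrt 2 : ℝ) : ℂ) * Complex.exp (-(Complex.I * θ)), -((Real.sqrt 3 : ℝ) : ℂ)]

theorem familyOne_eq_weightedShift (θ : ℝ) : familyOne θ = weightedShift (weightsOne θ) := by
  rw [familyOne, weightedShift, weightsOne]
  ext i j
  fin_cases i <;> fin_cases j <;> simp

theorem familyTwo_eq_weightedShift (θ : ℝ) : familyTwo θ = weightedShift (weightsTwo θ) := by
  rw [familyTwo, weightedShift, weightsTwo]
  ext i j
  fin_cases i <;> fin_cases j <;> simp

theorem shiftS_eq_weightedShift : shiftS = weightedShift (weightsOne 0) := by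
  rw [← familyOne_eq_weightedShift, shiftS, familyOne, Real.cos_pi_div_six]
  have : (1 / (Real.sqrt 3 / 2) : ℝ) = 2 / Real.sqrt 3 := by rw [one_div_div]
  rw [this]
  simp

theorem normSq_exp_I_mul (θ : ℝ) : Complex.normSq (Complex.exp (Complex.I * θ)) = 1 := by
  rw [mul_comm, Complex.normSq_eq_norm_sq, Complex.norm_exp_ofReal_mul_I, one_pow]

theorem normSq_exp_neg_I_mul (θ : ℝ) : Complex.normSq (Complex.exp (-(Complex.I * θ))) = 1 := by
  rw [Complex.exp_neg, map_inv₀, normSq_exp_I_mul, inv_one]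

theorem exp_I_mul_mul_exp_neg (θ : ℝ) :
    Complex.exp (Complex.I * θ) * Complex.exp (-(Complex.I * θ)) = 1 := by
  rw [← Complex.exp_add, add_neg_cancel, Complex.exp_zero]

theorem hasGramKernel_weightsOne (θ : ℝ) : HasGramKernel (weightsOne θ) familyKernel := by
  have h3 : Real.sqrt 3 * Real.sqrt 3 = 3 := Real.mul_self_sqrt (by norm_num)
  obtain ⟨s, hs⟩ : ∃ s : ℝ, s = 2 / Real.sqrt 3 := ⟨_, rfl⟩
  have hss : s * s = 4 / 3 := by rw [hs, div_mul_div_comm, h3]; norm_num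
  have hs2 : 1 / Real.sqrt 3 = s / 2 := by rw [hs]; ring
  have hsC : (s : ℂ) * s = 4 / 3 := by rw [← Complex.ofReal_mul, hss]; norm_num
  have he := exp_I_mul_mul_exp_neg θ
  -- The pivots follow from `d (k + 1) = 2 - |w k|² / d k` with `|w k|² = 4/3`. The phases enter
  -- only through a product equal to 1, because `d 2 = 1` annihilates the middle coordinate.
  have hk : weightedShiftKernel (weightsOne θ) ![2, 4 / 3, 1, 2 / 3] = familyKernel := by
    rw [weightedShiftKernel, weightsOne, familyKernel, hs2, ← hs]
    obtain ⟨e, heq⟩ : ∃ e, e = Complex.exp (Complex.I * θ) := ⟨_, rfl⟩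
    obtain ⟨e', heq'⟩ : ∃ e', e' = Complex.exp (-(Complex.I * θ)) := ⟨_, rfl⟩
    rw [← heq, ← heq'] at he ⊢
    funext i
    fin_cases i <;> simp
    · linear_combination (-9 / 16 * (s : ℂ) ^ 4) * he + (-9 / 16 * ((s : ℂ) ^ 2 + 4 / 3)) * hsC
    · linear_combination (-3 / 8 * (s : ℂ) ^ 3) * he + (-3 / 8 * (s : ℂ)) * hsC
    · ring
  have hg := weightedShift_gram (w := weightsOne θ) (d := ![2, 4 / 3, 1, 2 / 3])
    (by intro k; fin_cases k <;> norm_num) rfl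
    (by simp [weightsOne, ← hs, hss]; norm_num)
    (by simp [weightsOne, ← hs, normSq_exp_I_mul, -Complex.normSq_ofReal]; norm_num [hss])
    (by simp [weightsOne, ← hs, hss, normSq_exp_neg_I_mul]; norm_num)
    (by simp [weightsOne, ← hs, hss]; norm_num)
  rw [hk] at hg
  exact hg

theorem hasGramKernel_weightsTwo (θ : ℝ) : HasGramKernel (weightsTwo θ) familyKernel := by
  have h3 : Real.sqrt 3 * Real.sqrt 3 = 3 := Real.mul_self_sqrt (by norm_num)
  have h2 : Real.sqrt 2 * Real.sqrt 2 = 2 := Real.mul_self_sqrt (by norm_num)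
  obtain ⟨s, hs⟩ : ∃ s : ℝ, s = Real.sqrt 3 := ⟨_, rfl⟩
  obtain ⟨t, ht⟩ : ∃ t : ℝ, t = 1 / Real.sqrt 2 := ⟨_, rfl⟩
  rw [← hs] at h3
  have htt : t * t = 1 / 2 := by rw [ht, div_mul_div_comm, h2]; norm_num
  have hs0 : s ≠ 0 := by rintro rfl; norm_num at h3
  have hs2 : 1 / s = s / 3 := by field_simp; linarith
  have hsC : (s : ℂ) * s = 3 := by rw [← Complex.ofReal_mul, h3]; norm_num
  have htC : (t : ℂ) * t = 1 / 2 := by rw [← Complex.ofReal_mul, htt]; norm_num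
  have he := exp_I_mul_mul_exp_neg θ
  -- The same recursion with `|w k|² = 3, 1/2, 1/2, 3`; the kernel line is again the same.
  have hk : weightedShiftKernel (weightsTwo θ) ![2, 1 / 2, 1, 3 / 2] = familyKernel := by
    rw [weightedShiftKernel, weightsTwo, familyKernel, ← hs, hs2, ← ht]
    obtain ⟨e, heq⟩ : ∃ e, e = Complex.exp (Complex.I * θ) := ⟨_, rfl⟩
    obtain ⟨e', heq'⟩ : ∃ e', e' = Complex.exp (-(Complex.I * θ)) := ⟨_, rfl⟩
    rw [← heq, ← heq'] at he ⊢
    funext i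
    fin_cases i <;> simp
    · linear_combination (-2 / 3 * (s : ℂ) ^ 2 * t ^ 2) * he + (-2 / 3 * (s : ℂ) ^ 2) * htC +
        (-1 / 3 : ℂ) * hsC
    · linear_combination (-2 / 3 * (s : ℂ) * t ^ 2) * he + (-2 / 3 * (s : ℂ)) * htC
    · ring
  have hg := weightedShift_gram (w := weightsTwo θ) (d := ![2, 1 / 2, 1, 3 / 2])
    (by intro k; fin_cases k <;> norm_num) rfl
    (by simp [weightsTwo, ← hs, h3]; norm_num)
    (by simp [weightsTwo, ← ht, htt, normSq_exp_I_mul]; norm_num)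
    (by simp [weightsTwo, ← ht, htt, normSq_exp_neg_I_mul]; norm_num)
    (by simp [weightsTwo, ← hs, h3])
  rw [hk] at hg
  exact hg

theorem toeplitzForm_shiftS_familyKernel :
    toeplitzForm (matOp shiftS) 1 5 (coordinateVectors familyKernel) = 0 := by
  have h := toeplitzForm_of_isGradedBy (isGradedBy_weightedShift (weightsOne 0))
    (weightedShiftSum_apply_of_lt _) familyKernel
  rw [((hasGramKernel_weightsOne 0).2 familyKernel).2 (by simp [familyKernel]), dotProduct_zero,
    ← shiftS_eq_weightedShift, Complex.zero_re] at h
  linarith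

end Families

/-! ### Operator relations forced by a Toeplitz kernel vector -/

section Necessity

open Matrix

/-- The Toeplitz kernel relations for five vectors, the middle one being zero, in a recursive
form. -/
theorem toeplitz_kernel_recursion {H : Type*} [NormedAddCommGroup H] [InnerProductSpace ℂ H]
    [CompleteSpace H] {T : H →L[ℂ] H} (hT : IsRhoContraction 2 T) {w : ℕ → H}
    (hw : toeplitzForm T 1 5 w ≤ 0) (hw2 : w 2 = 0) :
    T (w 0) = 0 ∧ ContinuousLinearMap.adjoint T (w 4) = 0 ∧
    ∃ f g h : H, h = w 3 + T (w 4) ∧ T h = g ∧ f = w 1 + T g ∧ T f = (-2 : ℂ) • w 0 ∧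
      f = -w 1 - ContinuousLinearMap.adjoint T (w 0) ∧ ContinuousLinearMap.adjoint T f = g ∧
      h = -w 3 + ContinuousLinearMap.adjoint T g ∧
      ContinuousLinearMap.adjoint T h = (2 : ℂ) • w 4 := by
  obtain ⟨hk, hlast⟩ := hT.toeplitz_kernel hw
  obtain ⟨S, hS⟩ : ∃ S, S = ContinuousLinearMap.adjoint T := ⟨_, rfl⟩
  rw [← hS]
  have m0 := hk 0
  have m1 := hk 1
  have m2 := hk 2
  have m3 := hk 3
  have m4 := hk 4
  have m5 := hk 5
  simp [Finset.sum_range_succ, toeplitzEntry, hw2, ← hS, pow_succ] at m0 m1 m2 m3 m4 m5 hlast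
  -- Applying `T` to row 0 gives the row just above it (`hlast`) except that `T (w 0)` has
  -- coefficient 2 instead of 1; hence `T (w 0) = 0`. Rows 4 and 5 give the adjoint statement.
  have t0 := congrArg T m0
  have s4 := congrArg S m4
  simp only [map_add, map_smul, map_zero] at t0 s4
  have hT0 : T (w 0) = 0 := by
    have : (2 : ℂ) • T (w 0) - T (w 0) = 0 := by
      rw [← sub_eq_zero.2 (t0.trans hlast.symm)]
      module
    rw [← this]
    module
  have hS4 : S (w 4) = 0 := by
    have : (2 : ℂ) • S (w 4) - S (w 4) = 0 := by
      rw [← sub_eq_zero.2 (s4.trans m5.symm)]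
      module
    rw [← this]
    module
  -- Horner evaluation of the `T`-part of the rows; `w 2 = 0` is why `g` is just `T h`.
  refine ⟨hT0, hS4, w 1 + T (T (w 3 + T (w 4))), T (w 3 + T (w 4)), w 3 + T (w 4), rfl, rfl, rfl,
    ?_⟩
  simp only [map_add]
  have f1 : w 1 + (T (T (w 3)) + T (T (T (w 4)))) = -w 1 - S (w 0) := by
    rw [← sub_eq_zero, ← m1]; module
  have f2 : S (-w 1 - S (w 0)) = T (w 3) + T (T (w 4)) := by
    rw [map_sub, map_neg, eq_comm, ← sub_eq_zero, ← m2]; module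
  have f3 : w 3 + T (w 4) = -w 3 + S (T (w 3) + T (T (w 4))) := by
    rw [← f2, map_sub, map_neg, map_sub, map_neg, ← sub_eq_zero, ← m3]; module
  refine ⟨?_, f1, ?_, ?_, ?_⟩
  · rw [← sub_eq_zero, ← m0]; module
  · rw [← f2, ← f1]
    simp only [map_add]
  · rw [← map_add]; exact f3
  · rw [← map_add, f3, ← f2]
    simp only [map_add, map_sub, map_neg]
    rw [← sub_eq_zero]
    have : ∀ x : H, x = 0 → -x = 0 := fun x hx => by rw [hx, neg_zero]
    rw [← this _ m4]
    module

/-- The fourth power already suffices: `‖ν‖ ^ 4 ≤ 2`. The bound 2 on the square is the one that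
`middle_rigidity` needs. -/
theorem IsRhoContraction.norm_eigenvalue_sq_lt {H : Type*} [NormedAddCommGroup H]
    [InnerProductSpace ℂ H] [CompleteSpace H] {T : H →L[ℂ] H} (hT : IsRhoContraction 2 T)
    {ν : ℂ} {x : H} (hx : x ≠ 0) (h : T x = ν • x) : ‖ν‖ ^ 2 < 2 := by
  have hpow : ∀ n : ℕ, (T ^ n) x = ν ^ n • x := by
    intro n
    induction n with
    | zero => simp
    | succ n ih => rw [pow_succ, mul_apply_eq_comp, h, map_smul, ih, smul_smul, pow_succ']
  have h4 := hT.norm_pow_apply_le (n := 4) (by norm_num) x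
  rw [hpow, norm_smul, norm_pow] at h4
  have h5 := le_of_mul_le_mul_right h4 (norm_pos_iff.2 hx)
  by_contra! h6
  nlinarith [sq_nonneg (‖ν‖ ^ 2)]

/-- A monic cubic polynomial with a double root at zero. -/
theorem charpoly_eq_of_two_le_rootMultiplicity (R : Matrix (Fin 3) (Fin 3) ℂ)
    (h : 2 ≤ R.charpoly.rootMultiplicity 0) :
    ∃ ν : ℂ, R.charpoly = Polynomial.X ^ 2 * (Polynomial.X - Polynomial.C ν) := by
  have hne : R.charpoly ≠ 0 := R.charpoly_monic.ne_zero
  have hdvd := (Polynomial.le_rootMultiplicity_iff hne).1 h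
  rw [Polynomial.C_0, sub_zero] at hdvd
  obtain ⟨q, hq⟩ := hdvd
  have hqm : q.Monic := (Polynomial.monic_X_pow 2).of_mul_monic_left (hq ▸ R.charpoly_monic)
  have hdeg : R.charpoly.natDegree = 3 := by rw [R.charpoly_natDegree_eq_dim]; rfl
  have hq1 : q.natDegree = 1 := by
    rw [hq, (Polynomial.monic_X_pow 2).natDegree_mul hqm, Polynomial.natDegree_X_pow] at hdeg
    omega
  refine ⟨-q.coeff 0, ?_⟩
  rw [hq, Polynomial.C_neg, sub_neg_eq_add, ← hqm.eq_X_add_C hq1]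

theorem exists_mulVec_eq_smul_of_charpoly_root {n : Type*} [Fintype n] [DecidableEq n]
    {R : Matrix n n ℂ} {ν : ℂ} (h : R.charpoly.eval ν = 0) : ∃ v ≠ 0, R *ᵥ v = ν • v := by
  rw [eval_charpoly] at h
  obtain ⟨v, hv0, hv⟩ := exists_mulVec_eq_zero_iff.2 h
  refine ⟨v, hv0, ?_⟩
  rw [sub_mulVec, sub_eq_zero] at hv
  rw [← hv]
  simp [Matrix.scalar_apply, ← smul_one_eq_diagonal, smul_mulVec]

theorem exists_exp_I_mul_eq {z : ℂ} (hz : ‖z‖ = 1) :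
    ∃ θ : ℝ, Complex.exp (Complex.I * θ) = z ∧ Complex.exp (-(Complex.I * θ)) = z⁻¹ := by
  have h : Complex.exp (Complex.I * z.arg) = z := by
    have := Complex.norm_mul_exp_arg_mul_I z
    rw [hz, Complex.ofReal_one, one_mul, mul_comm] at this
    exact this
  exact ⟨z.arg, h, by rw [Complex.exp_neg, h]⟩

end Necessity

/-! ### The relations in coordinates and the determination of `T` -/

section Necessity

open Matrix

theorem matOp_apply (A : Matrix (Fin 5) (Fin 5) ℂ) (x : EuclideanSpace ℂ (Fin 5)) (i : Fin 5) :
    matOp A x i = A i 0 * x 0 + A i 1 * x 1 + A i 2 * x 2 + A i 3 * x 3 + A i 4 * x 4 := by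
  change (A *ᵥ x.ofLp) i = _
  rw [mulVec, dotProduct, Fin.sum_univ_five]

/-- The kernel relations in coordinates. -/
theorem kernel_relations {T : Matrix (Fin 5) (Fin 5) ℂ} (hT : IsRhoContraction 2 (matOp T))
    (hd : HarnackDominated 2 (matOp T) (matOp shiftS)) {σ : ℂ}
    (hσ : σ = ((1 / Real.sqrt 3 : ℝ) : ℂ)) :
    (∀ i, T i 0 = 0) ∧ (∀ j, T 4 j = 0) ∧ T 0 4 = 0 ∧
    ∃ f₁ f₂ f₃ g₁ g₂ g₃ h₁ h₂ h₃ : ℂ,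
      (h₁ = T 1 4 ∧ h₂ = T 2 4 ∧ h₃ = σ + T 3 4) ∧
      (T 0 1 * h₁ + T 0 2 * h₂ + T 0 3 * h₃ = 0 ∧ T 1 1 * h₁ + T 1 2 * h₂ + T 1 3 * h₃ = g₁ ∧
        T 2 1 * h₁ + T 2 2 * h₂ + T 2 3 * h₃ = g₂ ∧ T 3 1 * h₁ + T 3 2 * h₂ + T 3 3 * h₃ = g₃) ∧
      (T 0 1 * g₁ + T 0 2 * g₂ + T 0 3 * g₃ = 0 ∧
        f₁ = -σ + (T 1 1 * g₁ + T 1 2 * g₂ + T 1 3 * g₃) ∧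
        f₂ = T 2 1 * g₁ + T 2 2 * g₂ + T 2 3 * g₃ ∧ f₃ = T 3 1 * g₁ + T 3 2 * g₂ + T 3 3 * g₃) ∧
      T 0 1 * f₁ + T 0 2 * f₂ + T 0 3 * f₃ = 2 ∧
      (f₁ = σ + conj (T 0 1) ∧ f₂ = conj (T 0 2) ∧ f₃ = conj (T 0 3)) ∧
      (conj (T 1 1) * f₁ + conj (T 2 1) * f₂ + conj (T 3 1) * f₃ = g₁ ∧
        conj (T 1 2) * f₁ + conj (T 2 2) * f₂ + conj (T 3 2) * f₃ = g₂ ∧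
        conj (T 1 3) * f₁ + conj (T 2 3) * f₂ + conj (T 3 3) * f₃ = g₃) ∧
      (h₁ = conj (T 1 1) * g₁ + conj (T 2 1) * g₂ + conj (T 3 1) * g₃ ∧
        h₂ = conj (T 1 2) * g₁ + conj (T 2 2) * g₂ + conj (T 3 2) * g₃ ∧
        h₃ = -σ + (conj (T 1 3) * g₁ + conj (T 2 3) * g₂ + conj (T 3 3) * g₃)) ∧
      conj (T 1 1) * h₁ + conj (T 2 1) * h₂ + conj (T 3 1) * h₃ = 0 ∧
      conj (T 1 4) * h₁ + conj (T 2 4) * h₂ + conj (T 3 4) * h₃ = 2 := by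
  obtain ⟨c, hc⟩ := hd.toeplitzForm_le
  have hform := hc 5 (coordinateVectors familyKernel)
  rw [toeplitzForm_shiftS_familyKernel, mul_zero] at hform
  have w0 : coordinateVectors familyKernel 0 = EuclideanSpace.single 0 (-1) :=
    coordinateVectors_apply familyKernel 0
  have w1 : coordinateVectors familyKernel 1 = EuclideanSpace.single 1 (-σ) := by
    rw [hσ]; exact coordinateVectors_apply familyKernel 1
  have w2 : coordinateVectors familyKernel 2 = 0 := by
    refine (coordinateVectors_apply familyKernel 2).trans ?_
    simp [familyKernel]
  have w3 : coordinateVectors familyKernel 3 = EuclideanSpace.single 3 σ := by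
    rw [hσ]; exact coordinateVectors_apply familyKernel 3
  have w4 : coordinateVectors familyKernel 4 = EuclideanSpace.single 4 1 :=
    coordinateVectors_apply familyKernel 4
  obtain ⟨r1, r2, f, g, h, r3, r4, r5, r6, r7, r8, r9, r10⟩ := toeplitz_kernel_recursion hT hform w2
  rw [adjoint_matOp] at r2 r7 r8 r9 r10
  rw [w0] at r1 r6 r7
  rw [w1] at r5 r7
  rw [w3] at r3 r9
  rw [w4] at r2 r3 r10
  have coord : ∀ {x y : EuclideanSpace ℂ (Fin 5)}, x = y → ∀ i, x i = y i := fun h i => by rw [h]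
  have r1 : ∀ i, T i 0 = 0 := fun i => by
    have := coord r1 i
    simpa [matOp_apply] using this
  have r2 : ∀ j, T 4 j = 0 := fun j => by
    have := coord r2 j
    simpa [matOp_apply] using this
  have r3 := coord r3
  have r4 := coord r4
  have r5 := coord r5
  have r6 := coord r6
  have r7 := coord r7
  have r8 := coord r8
  have r9 := coord r9
  have r10 := coord r10
  have hf0 := r7 0
  have hf4 := r5 4
  have hg0 := r8 0
  have hg4 := r4 4
  have hh0 := r9 0
  have hh4 := r3 4
  -- The zeroth coordinate of `h` is `T 0 4` by one formula. By the other it is zero, as the first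
  -- column of `T` vanishes.
  have hT04 := r3 0
  simp [matOp_apply, r1, r2] at hf0 hf4 hg0 hg4 hh0 hh4 hT04
  rw [hh0] at hT04
  refine ⟨r1, r2, hT04.symm, f 1, f 2, f 3, g 1, g 2, g 3, h 1, h 2, h 3, ?_⟩
  simp [matOp_apply, Fin.forall_fin_succ, r1, r2, ← hT04, hf0, hf4, ← hg0, ← hg4, hh0, hh4]
    at r3 r4 r5 r6 r7 r8 r9 r10
  exact ⟨r3, r4, ⟨r5.1.symm, r5.2⟩, r6.1, r7, ⟨r8.1, r8.2.1, r8.2.2.1⟩, ⟨r9.1, r9.2.1, r9.2.2.1⟩,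
    r10.1, r10.2.2.2⟩

theorem middleBlock_mulVec (T : Matrix (Fin 5) (Fin 5) ℂ) (x : Fin 3 → ℂ) :
    middleBlock T *ᵥ x = ![T 1 1 * x 0 + T 1 2 * x 1 + T 1 3 * x 2,
      T 2 1 * x 0 + T 2 2 * x 1 + T 2 3 * x 2, T 3 1 * x 0 + T 3 2 * x 1 + T 3 3 * x 2] := by
  funext i
  fin_cases i <;> simp [middleBlock, mulVec, dotProduct, Fin.sum_univ_three]

theorem middleBlock_conjTranspose_mulVec (T : Matrix (Fin 5) (Fin 5) ℂ) (x : Fin 3 → ℂ) :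
    (middleBlock T)ᴴ *ᵥ x = ![conj (T 1 1) * x 0 + conj (T 2 1) * x 1 + conj (T 3 1) * x 2,
      conj (T 1 2) * x 0 + conj (T 2 2) * x 1 + conj (T 3 2) * x 2,
      conj (T 1 3) * x 0 + conj (T 2 3) * x 1 + conj (T 3 3) * x 2] := by
  funext i
  simp only [mulVec, dotProduct, Fin.sum_univ_three, conjTranspose_apply]
  fin_cases i <;> simp [middleBlock]

/-- An eigenvalue of the middle block of a `2`-contraction with zero first column and last row. -/
theorem norm_sq_lt_of_middleBlock_mulVec {T : Matrix (Fin 5) (Fin 5) ℂ}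
    (hT : IsRhoContraction 2 (matOp T)) (h0 : ∀ i, T i 0 = 0) (h4 : ∀ j, T 4 j = 0) {ν : ℂ}
    {v : Fin 3 → ℂ} (hv : v ≠ 0) (hνv : middleBlock T *ᵥ v = ν • v) : ‖ν‖ ^ 2 < 2 := by
  by_cases hν : ν = 0
  · rw [hν]; norm_num
  have e0 := congrFun hνv 0
  have e1 := congrFun hνv 1
  have e2 := congrFun hνv 2
  simp [middleBlock_mulVec] at e0 e1 e2
  -- The eigenvector of the middle block lifts to one of `T`: the last coordinate is 0 and the first
  -- is forced by row 0.
  refine hT.norm_eigenvalue_sq_lt (ν := ν)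
    (x := WithLp.toLp 2 ![ν⁻¹ * (T 0 1 * v 0 + T 0 2 * v 1 + T 0 3 * v 2), v 0, v 1, v 2, 0]) ?_ ?_
  · intro h
    apply hv
    have c1 := congrArg (fun x : EuclideanSpace ℂ (Fin 5) => x 1) h
    have c2 := congrArg (fun x : EuclideanSpace ℂ (Fin 5) => x 2) h
    have c3 := congrArg (fun x : EuclideanSpace ℂ (Fin 5) => x 3) h
    simp at c1 c2 c3
    funext i
    fin_cases i <;> simp [c1, c2, c3]
  · ext i
    rw [matOp_apply]
    fin_cases i <;> simp [h0, h4, e0, e1, e2, hν]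

theorem necessity {T : Matrix (Fin 5) (Fin 5) ℂ} (hT : IsRhoContraction 2 (matOp T))
    (hd : HarnackDominated 2 (matOp T) (matOp shiftS)) {ν : ℂ}
    (hR : (middleBlock T).charpoly = Polynomial.X ^ 2 * (Polynomial.X - Polynomial.C ν)) :
    ν = 0 ∧ ∃ θ : ℝ, T = familyOne θ ∨ T = familyTwo θ := by
  obtain ⟨s, hs⟩ : ∃ s : ℝ, s = Real.sqrt 3 := ⟨_, rfl⟩
  have hs3 : s * s = 3 := by rw [hs]; exact Real.mul_self_sqrt (by norm_num)
  have hs0 : s ≠ 0 := by rintro rfl; norm_num at hs3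
  have hsC : (s : ℂ) * s = 3 := by rw [← Complex.ofReal_mul, hs3]; norm_num
  obtain ⟨σ, hσ⟩ : ∃ σ : ℂ, σ = ((1 / Real.sqrt 3 : ℝ) : ℂ) := ⟨_, rfl⟩
  have hσs : (s : ℂ) * σ = 1 := by
    rw [hσ, ← hs, ← Complex.ofReal_mul, mul_one_div_cancel hs0, Complex.ofReal_one]
  obtain ⟨h0, h4, h04, f₁, f₂, f₃, g₁, g₂, g₃, h₁, h₂, h₃, ⟨a1, a2, a3⟩, ⟨b0, b1, b2, b3⟩,
    ⟨c0, c1, c2, c3⟩, d0, ⟨e1, e2, e3⟩, ⟨i1, i2, i3⟩, ⟨j1, j2, j3⟩, k1, k4⟩ :=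
    kernel_relations hT hd hσ
  obtain ⟨v, hv, hνv⟩ := exists_mulVec_eq_smul_of_charpoly_root (R := middleBlock T) (ν := ν)
    (by rw [hR]; simp)
  have hνlt := norm_sq_lt_of_middleBlock_mulVec hT h0 h4 hv hνv
  have hCH := aeval_self_charpoly (middleBlock T)
  rw [hR] at hCH
  simp only [map_mul, map_pow, map_sub, Polynomial.aeval_X, Polynomial.aeval_C] at hCH
  have hcube : ∀ x : Fin 3 → ℂ, middleBlock T *ᵥ (middleBlock T *ᵥ (middleBlock T *ᵥ x)) =
      ν • (middleBlock T *ᵥ (middleBlock T *ᵥ x)) := by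
    intro x
    have := congrArg (fun A => A *ᵥ x) hCH
    simp only [Algebra.algebraMap_eq_smul_one, mul_sub, sub_mulVec, zero_mulVec, sub_eq_zero,
      mul_smul_comm, mul_one, smul_mulVec, pow_two, ← mulVec_mulVec] at this
    exact this
  obtain ⟨a, ha⟩ : ∃ a : EuclideanSpace ℂ (Fin 3), a = WithLp.toLp 2 ![1, 0, 0] := ⟨_, rfl⟩
  obtain ⟨b, hb⟩ : ∃ b : EuclideanSpace ℂ (Fin 3), b = WithLp.toLp 2 ![0, 0, 1] := ⟨_, rfl⟩
  -- Scaling by `-√3` turns the kernel entries `∓1/√3` in the formulas for `f` and `h` into the unit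
  -- vectors `a` and `b`. It also turns the constant 2 in `d0` and `k4` into 6.
  obtain ⟨f, hf⟩ : ∃ f : EuclideanSpace ℂ (Fin 3),
    f = WithLp.toLp 2 ![-s * f₁, -s * f₂, -s * f₃] := ⟨_, rfl⟩
  obtain ⟨g, hg⟩ : ∃ g : EuclideanSpace ℂ (Fin 3),
    g = WithLp.toLp 2 ![-s * g₁, -s * g₂, -s * g₃] := ⟨_, rfl⟩
  obtain ⟨h, hh⟩ : ∃ h : EuclideanSpace ℂ (Fin 3),
    h = WithLp.toLp 2 ![-s * h₁, -s * h₂, -s * h₃] := ⟨_, rfl⟩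
  obtain ⟨R, hRdef⟩ : ∃ R, R = toEuclideanLin (middleBlock T) := ⟨_, rfl⟩
  obtain ⟨Rs, hRs⟩ : ∃ Rs, Rs = toEuclideanLin (middleBlock T)ᴴ := ⟨_, rfl⟩
  have Rapp : ∀ x, R x = WithLp.toLp 2 (middleBlock T *ᵥ x.ofLp) := fun x => by rw [hRdef]; rfl
  have Rsapp : ∀ x, Rs x = WithLp.toLp 2 ((middleBlock T)ᴴ *ᵥ x.ofLp) := fun x => by rw [hRs]; rfl
  have hfa : f + a = WithLp.toLp 2 ![-s * conj (T 0 1), -s * conj (T 0 2), -s * conj (T 0 3)] := by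
    rw [hf, ha, ← WithLp.toLp_add]
    congr 1
    funext i
    fin_cases i <;> simp [e1, e2, e3]
    linear_combination -hσs
  have hhb : h + b = WithLp.toLp 2 ![-s * T 1 4, -s * T 2 4, -s * T 3 4] := by
    rw [hh, hb, ← WithLp.toLp_add]
    congr 1
    funext i
    fin_cases i <;> simp [a1, a2, a3]
    linear_combination -hσs
  have hRh : R h = g := by
    rw [Rapp, hh, hg, middleBlock_mulVec]
    congr 1
    funext i
    fin_cases i <;> simp
    · linear_combination (-s : ℂ) * b1
    · linear_combination (-s : ℂ) * b2
    · linear_combination (-s : ℂ) * b3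
  have hRf : Rs f = g := by
    rw [Rsapp, hf, hg, middleBlock_conjTranspose_mulVec]
    congr 1
    funext i
    fin_cases i <;> simp
    · linear_combination (-s : ℂ) * i1
    · linear_combination (-s : ℂ) * i2
    · linear_combination (-s : ℂ) * i3
  have hfR : f = a + R g := by
    rw [Rapp, hf, hg, ha, middleBlock_mulVec, ← WithLp.toLp_add]
    congr 1
    funext i
    fin_cases i <;> simp
    · linear_combination (-s : ℂ) * c1 + hσs
    · linear_combination (-s : ℂ) * c2
    · linear_combination (-s : ℂ) * c3
  have hhR : h = b + Rs g := by
    rw [Rsapp, hh, hg, hb, middleBlock_conjTranspose_mulVec, ← WithLp.toLp_add]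
    congr 1
    funext i
    fin_cases i <;> simp
    · linear_combination (-s : ℂ) * j1
    · linear_combination (-s : ℂ) * j2
    · linear_combination (-s : ℂ) * j3 + hσs
  have inner3 : ∀ x y : EuclideanSpace ℂ (Fin 3),
      ⟪x, y⟫_ℂ = conj (x 0) * y 0 + conj (x 1) * y 1 + conj (x 2) * y 2 := by
    intro x y
    rw [PiLp.inner_apply, Fin.sum_univ_three]
    simp [mul_comm]
  obtain ⟨hν0, ga, gb, hcases⟩ := middle_rigidity (μ := ν) (by simp) R Rs
    (fun x y => by
      rw [hRdef, hRs, Matrix.toEuclideanLin_conjTranspose_eq_adjoint,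
        LinearMap.adjoint_inner_left])
    hνlt (fun x => by
      simp only [Rapp]
      rw [hcube]
      rfl)
    hRh hRf hfR hhR (by rw [inner3, ha]; simp) (by rw [inner3, hb]; simp)
    (by rw [inner3, ha, hb]; simp)
    (by
      rw [hfa, hg, inner3]
      simp
      linear_combination (s * s : ℂ) * c0)
    (by
      rw [hfa, hh, inner3]
      simp
      linear_combination (s * s : ℂ) * b0)
    (by
      rw [hfa, hf, inner3]
      simp
      linear_combination (s * s : ℂ) * d0 + 2 * hsC)
    (by
      rw [hhb, hh, inner3]
      simp
      linear_combination (s * s : ℂ) * k4 + 2 * hsC)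
  refine ⟨hν0, ?_⟩
  have hsC0 : (s : ℂ) ≠ 0 := by exact_mod_cast hs0
  have hσ3 : σ = s / 3 := by linear_combination (s / 3 : ℂ) * hσs - (σ / 3) * hsC
  have hg₁ : g₁ = 0 := by
    rw [inner3, hg, ha] at ga
    simpa [hsC0] using ga
  have hg₃ : g₃ = 0 := by
    rw [inner3, hg, hb] at gb
    simpa [hsC0] using gb
  have hgn : ‖g‖ ^ 2 = 3 * Complex.normSq g₂ := by
    rw [EuclideanSpace.norm_sq_eq, Fin.sum_univ_three, hg]
    simp [hg₁, hg₃, Complex.normSq_eq_norm_sq, pow_two]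
    linear_combination ‖g₂‖ ^ 2 * ((abs_mul_abs_self s).trans hs3)
  -- Now `f`, `g`, `h` are nonzero multiples of the first, second and third basis vectors, so the
  -- relations read off rows and columns of `R`. The corner `T 3 1` comes from the extra relation
  -- `k1`.
  have entries : ∀ c : ℂ, 1 + c ≠ 0 → g₂ ≠ 0 → R g = c • a → Rs g = c • b →
      -s * f₁ = 1 + c ∧ f₂ = 0 ∧ f₃ = 0 ∧ h₁ = 0 ∧ h₂ = 0 ∧ -s * h₃ = 1 + c ∧
        T 1 1 = 0 ∧ T 2 1 = 0 ∧ T 3 1 = 0 ∧ T 2 2 = 0 ∧ T 3 2 = 0 ∧ T 1 3 = 0 ∧ T 3 3 = 0 ∧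
        T 1 2 * g₂ = f₁ + σ ∧ T 2 3 * h₃ = g₂ := by
    intro c hc hg₂ h1 h2
    rw [h1] at hfR
    rw [h2] at hhR
    have p1 := congrArg (fun x : EuclideanSpace ℂ (Fin 3) => x 0) hfR
    have p2 := congrArg (fun x : EuclideanSpace ℂ (Fin 3) => x 1) hfR
    have p3 := congrArg (fun x : EuclideanSpace ℂ (Fin 3) => x 2) hfR
    have q1 := congrArg (fun x : EuclideanSpace ℂ (Fin 3) => x 0) hhR
    have q2 := congrArg (fun x : EuclideanSpace ℂ (Fin 3) => x 1) hhR
    have q3 := congrArg (fun x : EuclideanSpace ℂ (Fin 3) => x 2) hhR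
    simp [hf, hh, ha, hb, hsC0] at p1 p2 p3 q1 q2 q3
    have hf₁ : f₁ ≠ 0 := by
      rintro rfl
      exact hc (by rw [← p1]; ring)
    have hh₃ : h₃ ≠ 0 := by
      rintro rfl
      exact hc (by rw [← q3]; ring)
    simp [hg₁, hg₃, p2, p3, q1, q2, hf₁, hh₃, hg₂] at b1 b2 b3 c1 c2 c3 i1 i2 i3 j1 j2 j3 k1
    exact ⟨by rw [← p1]; ring, p2, p3, q1, q2, by rw [← q3]; ring, i1, j1, k1,
      by simpa [p2, hg₂] using c2, by simpa [p3, hg₂] using c3, b1, b3, by rw [c1]; ring, b2⟩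
  rcases hcases with ⟨hn, hRg, hRsg⟩ | ⟨hn, hRg, hRsg⟩
  · rw [hgn] at hn
    have hg₂ : g₂ ≠ 0 := by
      rintro rfl
      simp at hn
    obtain ⟨p1, p2, p3, q1, q2, q3, t11, t21, t31, t22, t32, t13, t33, t12, t23⟩ :=
      entries (-4) (by norm_num) hg₂ hRg hRsg
    -- From `‖g‖ ^ 2 = 12` comes `|g₂| = 2`, and `T 1 2 = (4s/3) / g₂`; so `2 / g₂` is the phase.
    have hz : ‖2 / g₂‖ = 1 := by
      have : ‖g₂‖ ^ 2 = 2 ^ 2 := by rw [← Complex.normSq_eq_norm_sq]; linarith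
      have := (pow_left_inj₀ (norm_nonneg _) (by norm_num) two_ne_zero).1 this
      rw [norm_div, this]
      norm_num
    obtain ⟨θ, hθ1, hθ2⟩ := exists_exp_I_mul_eq hz
    refine ⟨θ, Or.inl ?_⟩
    have hs' : (2 / Real.sqrt 3 : ℝ) = 2 * s / 3 := by
      rw [← hs]; field_simp; linarith
    have ef : f₁ = s := by linear_combination (-s / 3 : ℂ) * p1 - f₁ / 3 * hsC
    have eh : h₃ = s := by linear_combination (-s / 3 : ℂ) * q3 - h₃ / 3 * hsC
    have t01 : conj (T 0 1) = 2 * s / 3 := by linear_combination ef - e1 - hσ3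
    have t01' : T 0 1 = 2 * s / 3 := by
      rw [← Complex.conj_conj (T 0 1), t01]; simp [Complex.conj_ofNat]
    have t34 : T 3 4 = 2 * s / 3 := by linear_combination eh - a3 - hσ3
    have t02 : T 0 2 = 0 := by rw [p2] at e2; simpa using e2.symm
    have t03 : T 0 3 = 0 := by rw [p3] at e3; simpa using e3.symm
    have t14 : T 1 4 = 0 := by rw [← a1, q1]
    have t24 : T 2 4 = 0 := by rw [← a2, q2]
    have t12' : T 1 2 = 2 * s / 3 * (2 / g₂) := by
      field_simp
      linear_combination 3 * t12 + 3 * ef + 3 * hσ3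
    have t23' : T 2 3 = 2 * s / 3 * (2 / g₂)⁻¹ := by
      rw [eh] at t23
      rw [inv_div]
      linear_combination (s / 3 : ℂ) * t23 - T 2 3 / 3 * hsC
    rw [familyOne, hθ1, hθ2, hs']
    ext i j
    fin_cases i <;> fin_cases j <;>
      simp [h0, h4, h04, t01', t02, t03, t11, t12', t13, t14, t21, t22, t23', t24, t31, t32, t33,
        t34]
  · rw [hgn] at hn
    have hg₂ : g₂ ≠ 0 := by
      rintro rfl
      simp at hn
    obtain ⟨p1, p2, p3, q1, q2, q3, t11, t21, t31, t22, t32, t13, t33, t12, t23⟩ :=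
      entries 1 (by norm_num) hg₂ (by rw [one_smul]; exact hRg) (by rw [one_smul]; exact hRsg)
    obtain ⟨t, ht⟩ : ∃ t : ℝ, t = 1 / Real.sqrt 2 := ⟨_, rfl⟩
    have htt : t * t = 1 / 2 := by
      rw [ht, div_mul_div_comm, Real.mul_self_sqrt (by norm_num)]; norm_num
    have htC : (t : ℂ) * t = 1 / 2 := by rw [← Complex.ofReal_mul, htt]; norm_num
    have ht0 : (t : ℂ) ≠ 0 := by
      intro h
      rw [h] at htC
      norm_num at htC
    -- Here `T 1 2 = -s / (3 g₂)`; dividing by `t = 1/√2` with `2 t² = 1` isolates the phase.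
    have hz : ‖-(2 * t * s) / (3 * g₂)‖ = 1 := by
      rw [← pow_left_inj₀ (norm_nonneg _) zero_le_one two_ne_zero, ← Complex.normSq_eq_norm_sq,
        Complex.normSq_div, Complex.normSq_neg]
      simp only [map_mul, Complex.normSq_ofReal, htt, hs3, Complex.normSq_ofNat]
      have : Complex.normSq g₂ = 2 / 3 := by linarith
      rw [this]
      norm_num
    obtain ⟨θ, hθ1, hθ2⟩ := exists_exp_I_mul_eq hz
    refine ⟨θ, Or.inr ?_⟩
    have ef : f₁ = -(2 * s / 3) := by linear_combination (-s / 3 : ℂ) * p1 - f₁ / 3 * hsC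
    have eh : h₃ = -(2 * s / 3) := by linear_combination (-s / 3 : ℂ) * q3 - h₃ / 3 * hsC
    have t01 : conj (T 0 1) = -s := by linear_combination ef - e1 - hσ3
    have t01' : T 0 1 = -s := by
      rw [← Complex.conj_conj (T 0 1), t01]; simp
    have t34 : T 3 4 = -s := by linear_combination eh - a3 - hσ3
    have t02 : T 0 2 = 0 := by rw [p2] at e2; simpa using e2.symm
    have t03 : T 0 3 = 0 := by rw [p3] at e3; simpa using e3.symm
    have t14 : T 1 4 = 0 := by rw [← a1, q1]
    have t24 : T 2 4 = 0 := by rw [← a2, q2]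
    have t12' : T 1 2 = t * (-(2 * t * s) / (3 * g₂)) := by
      field_simp
      linear_combination 3 * t12 + 3 * ef + 3 * hσ3 + 2 * s * htC
    have t23' : T 2 3 = t * (-(2 * t * s) / (3 * g₂))⁻¹ := by
      rw [eh] at t23
      rw [inv_div]
      field_simp
      linear_combination -3 * t23
    rw [familyTwo, hθ1, hθ2, ← ht, ← hs]
    ext i j
    fin_cases i <;> fin_cases j <;>
      simp [h0, h4, h04, t01', t02, t03, t11, t12', t13, t14, t21, t22, t23', t24, t31, t32, t33,
        t34]

end Necessity

/-! ### The theorem -/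

theorem mainTheorem2 :
    (∀ (T : Matrix (Fin 5) (Fin 5) ℂ) (μ : ℂ),
      matOp T ∈ harnackPart 2 (matOp shiftS) →
      spectrum ℂ (middleBlock T) = {0, μ} →
      2 ≤ (middleBlock T).charpoly.rootMultiplicity 0 →
        μ = 0 ∧ (middleBlock T).charpoly.rootMultiplicity 0 = 3 ∧
        IsNilpotent (middleBlock T) ∧
        ∃ θ : ℝ, T = familyOne θ ∨ T = familyTwo θ) ∧
    (∀ θ : ℝ, matOp (familyOne θ) ∈ harnackPart 2 (matOp shiftS) ∧
      matOp (familyTwo θ) ∈ harnackPart 2 (matOp shiftS)) := by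
  constructor
  · rintro T μ ⟨hT, -, hd, -⟩ hspec hmult
    obtain ⟨ν, hν⟩ := charpoly_eq_of_two_le_rootMultiplicity _ hmult
    obtain ⟨rfl, hθ⟩ := necessity hT hd hν
    have hX : (middleBlock T).charpoly = Polynomial.X ^ 3 := by
      rw [hν, Polynomial.C_0, sub_zero, pow_succ _ 2]
    refine ⟨?_, ?_, ⟨3, ?_⟩, hθ⟩
    · have hμ : μ ∈ spectrum ℂ (middleBlock T) := by simp [hspec]
      rw [Matrix.mem_spectrum_iff_isRoot_charpoly, hX] at hμ
      simpa using hμ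
    · have := Polynomial.rootMultiplicity_X_sub_C_pow (0 : ℂ) 3
      rw [hX]
      simpa using this
    · have := Matrix.aeval_self_charpoly (middleBlock T)
      rwa [hX, map_pow, Polynomial.aeval_X] at this
  · intro θ
    rw [shiftS_eq_weightedShift, familyOne_eq_weightedShift, familyTwo_eq_weightedShift]
    exact ⟨(hasGramKernel_weightsOne θ).mem_harnackPart (hasGramKernel_weightsOne 0),
      (hasGramKernel_weightsTwo θ).mem_harnackPart (hasGramKernel_weightsOne 0)⟩
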